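/- Let $A\in\mathbb R^{d\times d}$, $B\in\mathbb R^{d\times m}$, $K\in\mathbb R^{m\times d}$, with $A$ invertible and $A$, $BK$ commuting. Let $\xi_1,\xi_2,\dots$ be i.i.d. positive random variables with $\mathbb E[e^{r\xi_1}]<\infty$ for some $r>0$, put $M=\mathbb E[\xi_1^2]/(2\,\mathbb E[\xi_1])$, and let $W$ be a standard $d$-dimensional Brownian motion independent of $(\xi_i)$. For $n\ge 1$ set $\tau^n_k=\frac1n\sum_{i=1}^k\xi_i$ ($\tau^n_0=0$), $N^n_t=\sup\{k\ge 0:\tau^n_k\le t\}$ and $\pi^n(t)=\tau^n_{N^n_t}$. Let $x_0\in\mathbb R^d$ and, for $t\ge0$, let $$x_t=x_0+\int_0^t(A-BK)x_s\,ds,\qquad X^{\varepsilon,n}_t=x_0+\int_0^t\big(AX^{\varepsilon,n}_s-BK\,X^{\varepsilon,n}_{\pi^n(s)}\big)ds+\varepsilon W_t,$$ where $x$ and the paths of $X^{\varepsilon,n}$ are continuous. Let $|\cdot|$ be the Euclidean norm. Consider Regime 3: $\varepsilon=\varepsilon_n>0$, $\varepsilon_n\to0$ and $\frac{1}{n\varepsilon_n}\to\infty$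 as $n\to\infty$. For each sign $\sigma\in\{-1,+1\}$ the equation $$Q_t=\int_0^t(A-BK)Q_s\,ds+\sigma\,BK\,M\int_0^t(A-BK)x_s\,ds,\qquad t\ge0,$$ has a unique continuous solution $Q=Q^{\sigma}$, which is deterministic, and the following hold. (i) There is $n_0$ such that for every $T>0$, every $n>n_0$ and both signs $\sigma$, $$\mathbb E\Big[\sup_{0\le t\le T}\big|X^{\varepsilon_n,n}_t-x_t-\tfrac1n Q^{\sigma}_t\big|\Big]\le C\Big(\frac1{n^{1/4}}+\varepsilon_n\sqrt n\Big),$$ where $C>0$ depends only on $A,B,K,T$, the law of $\xi_1$ and an upper bound for $|x_0|$; in particular not on $n$ or on the sequence $(\varepsilon_n)$. The number $n_0$ does not depend on $T$. (ii) The fluctuations at scale $1/n$ converge to the deterministic limit $Q^{+1}$: for every $T>0$, $$\lim_{n\to\infty}\mathbb E\Big[\sup_{0\le t\le T}\Big|\frac{X^{\varepsilon_n,n}_t-x_t}{1/n}-Q^{+1}_t\Big|\Big]=0.$$ -/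

import Mathlib

open MeasureTheory ProbabilityTheory Filter Topology
open scoped NNReal ENNReal

universe u

namespace SampledControl

noncomputable section

/-- The Euclidean space in which the state lives. -/
abbrev State (d : ℕ) : Type := EuclideanSpace ℝ (Fin d)

/-- The action of a square matrix on the Euclidean space. -/
def act {d : ℕ} (S : Matrix (Fin d) (Fin d) ℝ) (v : State d) : State d :=
  Matrix.toEuclideanCLM (n := Fin d) (𝕜 := ℝ) S v

/-- The constant `M = E[ξ₁²] / (2 E[ξ₁])`, where `ν` is the law of `ξ₁`. -/
def meanAge (ν : Measure ℝ) : ℝ := (∫ y, y ^ 2 ∂ν) / (2 * ∫ y, y ∂ν)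

/-- The sampling time `τⁿ_k = (ξ₁ + ⋯ + ξ_k) / n`. The list of waiting times is indexed from `0`,
so `ξ i` is the waiting time `ξ_{i+1}`. -/
def sampleTime {Ω : Type u} (ξ : ℕ → Ω → ℝ) (n k : ℕ) (ω : Ω) : ℝ :=
  ∑ i ∈ Finset.range k, ξ i ω / n

/-- The renewal process `Nⁿ_t = sup {k : τⁿ_k ≤ t}`. -/
def renewalCount {Ω : Type u} (ξ : ℕ → Ω → ℝ) (n : ℕ) (t : ℝ) (ω : Ω) : ℕ :=
  sSup {k : ℕ | sampleTime ξ n k ω ≤ t}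

/-- The last sampling time before `t`, that is `πⁿ(t) = τⁿ_{Nⁿ_t}`. -/
def lastSample {Ω : Type u} (ξ : ℕ → Ω → ℝ) (n : ℕ) (t : ℝ) (ω : Ω) : ℝ :=
  sampleTime ξ n (renewalCount ξ n t ω) ω

/-- A standard Brownian motion in `ℝ^d`: the coordinates are independent real Brownian motions. -/
structure IsBrownianVec {d : ℕ} {Ω : Type u} [MeasurableSpace Ω] (W : ℝ≥0 → Ω → State d)
    (P : Measure Ω) : Prop where
  measurable : ∀ t, Measurable (W t)
  brownian : ∀ i, IsBrownianReal (fun t ω => W t ω i) P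
  indep : iIndepFun (fun (i : Fin d) (ω : Ω) (t : ℝ≥0) => W t ω i) P

/-- The random inputs: i.i.d. waiting times with law `ν`, and a Brownian motion in `ℝ^d` that is
independent of them. -/
structure IsRandomInput {d : ℕ} {Ω : Type u} [MeasurableSpace Ω] (ν : Measure ℝ)
    (ξ : ℕ → Ω → ℝ) (W : ℝ≥0 → Ω → State d) (P : Measure Ω) : Prop where
  measurable : ∀ i, Measurable (ξ i)
  law : ∀ i, HasLaw (ξ i) ν P
  iindep : iIndepFun ξ P
  brownian : IsBrownianVec W P
  indep : IndepFun (fun ω i => ξ i ω) (fun ω t => W t ω) P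

/-- `x` solves the ideal closed loop equation `x_t = x₀ + ∫₀ᵗ (A - BK) x_s ds` for `t ≥ 0`. -/
structure IsClosedLoop {d m : ℕ} (A : Matrix (Fin d) (Fin d) ℝ) (B : Matrix (Fin d) (Fin m) ℝ)
    (K : Matrix (Fin m) (Fin d) ℝ) (x₀ : State d) (x : ℝ → State d) : Prop where
  cont : ContinuousOn x (Set.Ici 0)
  eqn : ∀ t : ℝ, 0 ≤ t → x t = x₀ + ∫ s in (0 : ℝ)..t, act (A - B * K) (x s)

/-- `X` solves the sampled equation with noise,
`X_t = x₀ + ∫₀ᵗ (A X_s - BK X_{πⁿ(s)}) ds + ε W_t` for `t ≥ 0`, with continuous paths. -/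
structure IsSampledSolution {d m : ℕ} {Ω : Type u} [MeasurableSpace Ω]
    (A : Matrix (Fin d) (Fin d) ℝ) (B : Matrix (Fin d) (Fin m) ℝ) (K : Matrix (Fin m) (Fin d) ℝ)
    (x₀ : State d) (ξ : ℕ → Ω → ℝ) (W : ℝ≥0 → Ω → State d) (P : Measure Ω)
    (ε : ℝ) (n : ℕ) (X : ℝ → Ω → State d) : Prop where
  measurable : ∀ t : ℝ, 0 ≤ t → Measurable (X t)
  cont : ∀ᵐ ω ∂P, ContinuousOn (fun t => X t ω) (Set.Ici 0)
  eqn : ∀ᵐ ω ∂P, ∀ t : ℝ≥0, X t ω = x₀ +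
    (∫ s in (0 : ℝ)..t, (act A (X s ω) - act (B * K) (X (lastSample ξ n s ω) ω))) + ε • W t ω

/-- `Q` solves `Q_t = ∫₀ᵗ (A - BK) Q_s ds + σ BK M ∫₀ᵗ (A - BK) x_s ds` for `t ≥ 0`,
where `σ` is a sign. -/
structure IsLimitFluctuation {d m : ℕ} (A : Matrix (Fin d) (Fin d) ℝ)
    (B : Matrix (Fin d) (Fin m) ℝ) (K : Matrix (Fin m) (Fin d) ℝ) (M σ : ℝ)
    (x Q : ℝ → State d) : Prop where
  cont : ContinuousOn Q (Set.Ici 0)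
  eqn : ∀ t : ℝ, 0 ≤ t → Q t = (∫ s in (0 : ℝ)..t, act (A - B * K) (Q s)) +
    σ • act (B * K) (M • ∫ s in (0 : ℝ)..t, act (A - B * K) (x s))

/-- The third regime: `ε_n > 0`, `ε_n → 0` and `1 / (n ε_n) → ∞` as `n → ∞`. -/
structure IsRegimeThree (ε : ℕ → ℝ) : Prop where
  pos : ∀ n, 0 < ε n
  tendsto_zero : Tendsto ε atTop (𝓝 0)
  tendsto_top : Tendsto (fun n : ℕ => 1 / ((n : ℝ) * ε n)) atTop atTop

end

end SampledControl

/-!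
The limit of the fluctuations is explicit. With `F = A - BK`, `D = BK` and `x t = exp (t F) x₀`,
the matrices `D` and `F` commute, so `Q t = σ M t • D F x t` solves the limit equation
(`isLimitFluctuation_fluctuation`). Uniqueness, and every stability estimate below, comes from a
Gronwall lemma for delayed linear equations, `norm_le_of_delayed_eq`.

Pathwise, `x + Q / n` (for `σ = 1`) solves the sampled equation up to a residual in which only the
smooth functions `x` and `Q` and the age `Δ s = s - π s` occur. Its leading term is the integral of
`(Δ - M / n) • F x`; integrating by parts bounds it by the primitive of `Δ - M / n`, and the other
terms are of order `Δ ^ 2` and `Δ / n`. Since the difference of the two solutions obeys the delayed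
equation with this residual and the noise as inhomogeneity, it is controlled by these quantities
(`exists_norm_sub_approx_le`).

At the renewal times the primitive of `Δ - M / n` equals `n⁻²` times a partial sum of the
independent variables `ξ ^ 2 / 2 - M ξ`, and `M` is the constant for which they are centred. A
pathwise form of Doob's inequality (`sq_runMax_le`) bounds the running maxima of such sums in mean
square by the sum of the variances. As at most `c n` renewals happen before `T`, up to an event of
probability `exp (-n)`, the error from sampling has mean `O (n ^ (-3 / 2))` (`exists_age_error`).
The same maximal inequality on finer and finer grids shows that the maximum of the Brownian motion
has finite mean (`exists_brownian_bound`), so the noise contributes `O (ε)`.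

Altogether the mean of `sup |X - x - Q / n|` is `O (ε + n ^ (-3 / 2))`
(`exists_lintegral_iSup_le`). This gives both assertions: `n ε → 0` in the regime considered, and
for `σ = -1` the difference of the two candidates `Q / n` is only `O (1 / n)`.
-/

namespace SampledControl

/-! ### Delayed linear integral equations -/

/-- A monotone time change of a continuous path is integrable. -/
theorem intervalIntegrable_comp_of_monotoneOn {E : Type*} [NormedAddCommGroup E]
    {f : ℝ → E} {p : ℝ → ℝ} {T t : ℝ}
    (hf : ContinuousOn f (Set.Icc 0 T)) (hp : MonotoneOn p (Set.Icc 0 T))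
    (hmaps : ∀ s ∈ Set.Icc 0 T, p s ∈ Set.Icc 0 s) (ht : t ∈ Set.Icc 0 T) :
    IntervalIntegrable (fun s => f (p s)) volume 0 t := by
  have hT : 0 ≤ T := ht.1.trans ht.2
  have hmem : ∀ s ∈ Set.Icc 0 T, p s ∈ Set.Icc 0 T := fun s hs =>
    ⟨(hmaps s hs).1, (hmaps s hs).2.trans hs.2⟩
  obtain ⟨c, hc⟩ := isCompact_Icc.exists_bound_of_continuousOn hf
  have hmeas : AEStronglyMeasurable (fun s => f (p s)) (volume.restrict (Set.Icc 0 T)) := by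
    have h1 : AEMeasurable p (volume.restrict (Set.Icc 0 T)) :=
      aemeasurable_restrict_of_monotoneOn measurableSet_Icc hp
    have h2 : Continuous (Set.IccExtend hT ((Set.Icc 0 T).domRestrict f)) :=
      (continuousOn_iff_continuous_domRestrict.1 hf).Icc_extend'
    refine (h2.comp_aestronglyMeasurable h1.aestronglyMeasurable).congr ?_
    filter_upwards [ae_restrict_mem measurableSet_Icc] with s hs
    exact Set.IccExtend_of_mem hT _ (hmem s hs)
  have hint : IntegrableOn (fun s => f (p s)) (Set.Icc 0 T) volume := by
    refine Integrable.of_bound hmeas c ?_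
    filter_upwards [ae_restrict_mem measurableSet_Icc] with s hs using hc _ (hmem s hs)
  rw [intervalIntegrable_iff_integrableOn_Icc_of_le ht.1]
  exact hint.mono_set (Set.Icc_subset_Icc_right ht.2)

section Deterministic

variable {E : Type*} [NormedAddCommGroup E] [NormedSpace ℝ E]

/-- Gronwall's lemma for a linear equation with a delayed argument. The supremum of
`exp (-l t) * ‖u t‖` is weighted so that the integral term contributes at most half of it; the
delay is harmless because the weight `exp (l s)` is increasing. -/
theorem norm_le_of_delayed_eq {A D : E →L[ℝ] E} {u r : ℝ → E} {p : ℝ → ℝ} {T a : ℝ}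
    (hu : ContinuousOn u (Set.Icc 0 T)) (hp : ∀ s ∈ Set.Icc 0 T, p s ∈ Set.Icc 0 s)
    (hr : ∀ t ∈ Set.Icc 0 T, ‖r t‖ ≤ a)
    (heq : ∀ t ∈ Set.Icc 0 T, u t = r t + ∫ s in (0 : ℝ)..t, (A (u s) - D (u (p s)))) :
    ∀ t ∈ Set.Icc 0 T, ‖u t‖ ≤ 2 * a * Real.exp ((2 * (‖A‖ + ‖D‖) + 1) * T) := by
  intro t ht
  have hT : 0 ≤ T := ht.1.trans ht.2
  set l : ℝ := 2 * (‖A‖ + ‖D‖) + 1 with hl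
  have hl0 : 0 < l := by positivity
  have ha : 0 ≤ a := (norm_nonneg _).trans (hr t ht)
  obtain ⟨t₀, ht₀, hmax⟩ := isCompact_Icc.exists_isMaxOn ⟨t, ht⟩
    (f := fun s => Real.exp (-(l * s)) * ‖u s‖)
    ((Continuous.continuousOn (by fun_prop)).mul hu.norm)
  set S : ℝ := Real.exp (-(l * t₀)) * ‖u t₀‖ with hS
  have hS0 : 0 ≤ S := by positivity
  have hbound : ∀ s ∈ Set.Icc 0 T, ‖u s‖ ≤ S * Real.exp (l * s) := by
    intro s hs
    have h : Real.exp (-(l * s)) * ‖u s‖ ≤ S := hmax hs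
    rw [Real.exp_neg, inv_mul_le_iff₀ (Real.exp_pos _)] at h
    linarith
  have hint : ‖∫ s in (0 : ℝ)..t₀, (A (u s) - D (u (p s)))‖
      ≤ ∫ s in (0 : ℝ)..t₀, (‖A‖ + ‖D‖) * S * Real.exp (l * s) := by
    refine intervalIntegral.norm_integral_le_of_norm_le ht₀.1 (ae_of_all _ fun s hs => ?_)
      (Continuous.intervalIntegrable (by fun_prop) _ _)
    have hs' : s ∈ Set.Icc 0 T := ⟨hs.1.le, hs.2.trans ht₀.2⟩
    have hps := hp s hs'
    have h1 := hbound s hs'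
    have h2 := hbound (p s) ⟨hps.1, hps.2.trans hs'.2⟩
    have h3 : S * Real.exp (l * p s) ≤ S * Real.exp (l * s) := by
      gcongr
      exact hps.2
    calc ‖A (u s) - D (u (p s))‖ ≤ ‖A (u s)‖ + ‖D (u (p s))‖ := norm_sub_le _ _
      _ ≤ ‖A‖ * ‖u s‖ + ‖D‖ * ‖u (p s)‖ := add_le_add (A.le_opNorm _) (D.le_opNorm _)
      _ ≤ ‖A‖ * (S * Real.exp (l * s)) + ‖D‖ * (S * Real.exp (l * s)) := by
        gcongr
        exact h2.trans h3
      _ = _ := by ring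
  have hcalc : ∫ s in (0 : ℝ)..t₀, (‖A‖ + ‖D‖) * S * Real.exp (l * s)
      = (‖A‖ + ‖D‖) * S * ((Real.exp (l * t₀) - 1) / l) := by
    rw [intervalIntegral.integral_const_mul, intervalIntegral.integral_comp_mul_left _ hl0.ne',
      integral_exp]
    simp [div_eq_inv_mul]
  have hhalf : (‖A‖ + ‖D‖) * S * ((Real.exp (l * t₀) - 1) / l) ≤ S * Real.exp (l * t₀) / 2 := by
    have h1 : (‖A‖ + ‖D‖) / l ≤ 1 / 2 := by
      rw [div_le_div_iff₀ hl0 two_pos]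
      linarith
    have h2 : 0 ≤ Real.exp (l * t₀) - 1 := by
      have : 0 ≤ l * t₀ := mul_nonneg hl0.le ht₀.1
      linarith [Real.one_le_exp this]
    calc (‖A‖ + ‖D‖) * S * ((Real.exp (l * t₀) - 1) / l)
        = (‖A‖ + ‖D‖) / l * (S * (Real.exp (l * t₀) - 1)) := by ring
      _ ≤ 1 / 2 * (S * (Real.exp (l * t₀) - 1)) := by gcongr
      _ ≤ _ := by linarith
  have hu0 : ‖u t₀‖ = S * Real.exp (l * t₀) := by
    rw [hS, mul_right_comm, ← Real.exp_add]
    simp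
  have h1 : ‖u t₀‖ ≤ a + S * Real.exp (l * t₀) / 2 := by
    conv_lhs => rw [heq t₀ ht₀]
    exact (norm_add_le _ _).trans (add_le_add (hr _ ht₀) (hint.trans (hcalc.le.trans hhalf)))
  have h2 : S ≤ 2 * a := by
    have h3 : S * Real.exp (l * t₀) ≤ 2 * a := by linarith
    have h4 : 1 ≤ Real.exp (l * t₀) := Real.one_le_exp (mul_nonneg hl0.le ht₀.1)
    nlinarith
  calc ‖u t‖ ≤ S * Real.exp (l * t) := hbound t ht
    _ ≤ 2 * a * Real.exp (l * T) := by
      gcongr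
      exact ht.2

/-- A continuous solution of a linear integral equation is determined by its inhomogeneity. -/
theorem eqOn_of_linear_integral_eq [CompleteSpace E] {F : E →L[ℝ] E} {u v b : ℝ → E}
    (hu : ContinuousOn u (Set.Ici 0)) (hv : ContinuousOn v (Set.Ici 0))
    (hueq : ∀ t, 0 ≤ t → u t = b t + ∫ s in (0 : ℝ)..t, F (u s))
    (hveq : ∀ t, 0 ≤ t → v t = b t + ∫ s in (0 : ℝ)..t, F (v s)) :
    Set.EqOn u v (Set.Ici 0) := by
  intro T hT
  have hi : ∀ f : ℝ → E, ContinuousOn f (Set.Ici 0) → ∀ t, 0 ≤ t →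
      IntervalIntegrable (fun s => F (f s)) volume 0 t := by
    intro f hf t ht
    refine ContinuousOn.intervalIntegrable (F.continuous.comp_continuousOn (hf.mono ?_))
    rw [Set.uIcc_of_le ht]
    exact Set.Icc_subset_Ici_self
  have key := norm_le_of_delayed_eq (A := F) (D := 0) (u := fun t => u t - v t) (r := fun _ => 0)
    (p := id) (T := T) (a := 0) ((hu.sub hv).mono Set.Icc_subset_Ici_self)
    (fun s hs => ⟨hs.1, le_rfl⟩) (fun _ _ => by simp) (fun t ht => by
      have h : ∀ s, F (u s - v s) - (0 : E →L[ℝ] E) (u (id s) - v (id s)) = F (u s) - F (v s) := by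
        intro s
        simp
      simp_rw [h]
      rw [intervalIntegral.integral_sub (hi u hu t ht.1) (hi v hv t ht.1), hueq t ht.1,
        hveq t ht.1]
      abel) T ⟨hT, le_rfl⟩
  have : ‖u T - v T‖ ≤ 0 := by simpa using key
  exact sub_eq_zero.1 (norm_le_zero_iff.1 this)

/-- Integration by parts turns a bound on the primitive of an oscillating weight `h` into a bound
on its integral against a smooth function. -/
theorem norm_integral_smul_le [CompleteSpace E] {h : ℝ → ℝ} {g g' : ℝ → E} {T c₀ c₁ b : ℝ}
    (hint : ∀ t ∈ Set.Icc 0 T, IntervalIntegrable h volume 0 t)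
    (hright : ∀ s ∈ Set.Ico 0 T, ContinuousWithinAt h (Set.Ici s) s)
    (hg : ∀ s, HasDerivAt g (g' s) s) (hg' : Continuous g')
    (hc₀ : ∀ s ∈ Set.Icc 0 T, ‖g s‖ ≤ c₀) (hc₁ : ∀ s ∈ Set.Icc 0 T, ‖g' s‖ ≤ c₁)
    (hb : ∀ t ∈ Set.Icc 0 T, |∫ s in (0 : ℝ)..t, h s| ≤ b) {t : ℝ} (ht : t ∈ Set.Icc 0 T) :
    ‖∫ s in (0 : ℝ)..t, h s • g s‖ ≤ b * (c₀ + T * c₁) := by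
  have hsub : ∀ s ∈ Set.Icc 0 t, s ∈ Set.Icc 0 T := fun s hs => ⟨hs.1, hs.2.trans ht.2⟩
  have hbn : 0 ≤ b := (abs_nonneg _).trans (hb t ht)
  have hparts := intervalIntegral.integral_smul_deriv_eq_deriv_smul_of_hasDeriv_right
    (a := 0) (b := t) (u := fun r => ∫ s in (0 : ℝ)..r, h s) (v := g) (u' := h) (v' := g')
    (intervalIntegral.continuousOn_primitive_interval' (hint t ht) Set.left_mem_uIcc)
    (fun s _ => (hg s).continuousAt.continuousWithinAt)
    (fun s hs => by
      rw [min_eq_left ht.1, max_eq_right ht.1] at hs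
      have hs' : s ∈ Set.Ico 0 T := ⟨hs.1.le, hs.2.trans_le ht.2⟩
      have hm : StronglyMeasurableAtFilter h (𝓝[Set.Ioi s] s) volume := by
        refine ⟨Set.Ioc s T, Ioc_mem_nhdsGT hs'.2, ?_⟩
        have h1 := (hint T ⟨ht.1.trans ht.2, le_rfl⟩).1.aestronglyMeasurable
        exact h1.mono_set (Set.Ioc_subset_Ioc_left hs'.1)
      exact (intervalIntegral.integral_hasDerivWithinAt_right (hint s (hsub s ⟨hs.1.le, hs.2.le⟩))
        (s := Set.Ici s) (t := Set.Ioi s) hm ((hright s hs').mono Set.Ioi_subset_Ici_self)).mono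
          Set.Ioi_subset_Ici_self)
    (fun s _ => (hg s).hasDerivWithinAt) (hint t ht) (hg'.intervalIntegrable _ _)
  simp only [intervalIntegral.integral_same, zero_smul, sub_zero] at hparts
  have h1 : ∫ s in (0 : ℝ)..t, h s • g s = (∫ s in (0 : ℝ)..t, h s) • g t
      - ∫ s in (0 : ℝ)..t, (∫ q in (0 : ℝ)..s, h q) • g' s := by
    rw [hparts]
    abel
  rw [h1]
  refine (norm_sub_le _ _).trans ?_
  have h2 : ‖(∫ s in (0 : ℝ)..t, h s) • g t‖ ≤ b * c₀ := by
    rw [norm_smul, Real.norm_eq_abs]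
    exact mul_le_mul (hb t ht) (hc₀ t ht) (norm_nonneg _) hbn
  have h3 : ‖∫ s in (0 : ℝ)..t, (∫ q in (0 : ℝ)..s, h q) • g' s‖ ≤ b * c₁ * |t - 0| := by
    refine intervalIntegral.norm_integral_le_of_norm_le_const fun s hs => ?_
    rw [Set.uIoc_of_le ht.1] at hs
    have hs' := hsub s ⟨hs.1.le, hs.2⟩
    rw [norm_smul, Real.norm_eq_abs]
    exact mul_le_mul (hb s hs') (hc₁ s hs') (norm_nonneg _) hbn
  have h4 : 0 ≤ c₁ := (norm_nonneg _).trans (hc₁ t ht)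
  have h5 : b * c₁ * |t - 0| ≤ b * c₁ * T := by
    rw [sub_zero, abs_of_nonneg ht.1]
    have := ht.2
    gcongr
  linarith

end Deterministic

/-! ### Comparison with the first order expansion -/

section Comparison

variable {E : Type*} [NormedAddCommGroup E] [NormedSpace ℝ E]

/-- Solutions of `x' = F x` are bounded on `[0, T]` in terms of the initial value. -/
theorem norm_le_of_linear_ode [CompleteSpace E] {F : E →L[ℝ] E} {x : ℝ → E} {T : ℝ}
    (hx : ∀ s, HasDerivAt x (F (x s)) s) :
    ∀ t ∈ Set.Icc 0 T, ‖x t‖ ≤ 2 * Real.exp ((2 * ‖F‖ + 1) * T) * ‖x 0‖ := by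
  intro t ht
  have hxc : Continuous x := continuous_iff_continuousAt.2 fun s => (hx s).continuousAt
  have := norm_le_of_delayed_eq (A := F) (D := 0) (u := x) (r := fun _ => x 0) (p := id) (T := T)
    (a := ‖x 0‖) hxc.continuousOn (fun s hs => ⟨hs.1, le_rfl⟩) (fun _ _ => le_rfl)
    (fun t _ => by
      have h := intervalIntegral.integral_eq_sub_of_hasDerivAt (a := 0) (b := t)
        (fun s _ => hx s) ((F.continuous.comp hxc).intervalIntegrable _ _)
      simp only [zero_apply, sub_zero, h]
      abel) t ht
  calc ‖x t‖ ≤ _ := this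
    _ = _ := by
      rw [norm_zero, add_zero]
      ring

theorem norm_sub_le_of_hasDerivAt {f f' : ℝ → E} {p s c : ℝ} (hps : p ≤ s)
    (hf : ∀ r, HasDerivAt f (f' r) r) (hc : ∀ r ∈ Set.Icc p s, ‖f' r‖ ≤ c) :
    ‖f s - f p‖ ≤ c * (s - p) := by
  have := (convex_Icc p s).norm_image_sub_le_of_norm_hasDerivWithin_le
    (fun r _ => (hf r).hasDerivWithinAt) hc ⟨le_rfl, hps⟩ ⟨hps, le_rfl⟩
  rwa [Real.norm_eq_abs, abs_of_nonneg (sub_nonneg.2 hps)] at this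

/-- First order expansion of a solution of `x' = F x`, with quadratic remainder. -/
theorem norm_sub_sub_smul_le {F : E →L[ℝ] E} {x : ℝ → E} {p s c : ℝ} (hps : p ≤ s)
    (hx : ∀ r, HasDerivAt x (F (x r)) r) (hc : ∀ r ∈ Set.Icc p s, ‖x r‖ ≤ c) :
    ‖x s - x p - (s - p) • F (x s)‖ ≤ ‖F‖ ^ 2 * c * (s - p) ^ 2 := by
  have hF : ∀ r ∈ Set.Icc p s, ‖F (x r)‖ ≤ ‖F‖ * c := fun r hr =>
    (F.le_opNorm _).trans (by gcongr; exact hc r hr)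
  have hd : ∀ r, HasDerivAt (fun r => x r - r • F (x s)) (F (x r) - F (x s)) r := by
    intro r
    convert! (hx r).sub ((hasDerivAt_id r).smul_const (F (x s))) using 1
    simp
  have h := norm_sub_le_of_hasDerivAt (c := ‖F‖ * (‖F‖ * c * (s - p))) hps hd (fun r hr => by
    rw [← map_sub, ← norm_neg, ← map_neg, neg_sub]
    refine (F.le_opNorm _).trans ?_
    gcongr
    refine (norm_sub_le_of_hasDerivAt (c := ‖F‖ * c) hr.2 hx fun q hq =>
      hF q ⟨hr.1.trans hq.1, hq.2⟩).trans ?_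
    have h0 : 0 ≤ ‖F‖ * c := (norm_nonneg _).trans (hF s ⟨hps, le_rfl⟩)
    have := hr.1
    gcongr)
  calc ‖x s - x p - (s - p) • F (x s)‖
      = ‖x s - s • F (x s) - (x p - p • F (x s))‖ := by
        congr 1
        rw [sub_smul]
        abel
    _ ≤ _ := h
    _ = _ := by ring

/-- The deterministic heart of the matter. Let `X` solve the delayed equation with perturbation
`y`, let `x` solve the undelayed one, and let `Δ s = s - p s` be the delay. Then `X` differs from
the first order approximation `x + δ • Q`, where `Q t = (M * t) • D (F (x t))`, by at most the size
of `y`, the integrals of `Δ ^ 2` and `δ * Δ`, and the primitive of `Δ - δ * M`. Indeed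
`X - x - δ • Q` solves the delayed equation whose inhomogeneity is `y` plus the residual of
`x + δ • Q`, and that residual only involves the smooth functions `x` and `Q`. -/
theorem exists_norm_sub_approx_le [CompleteSpace E] {A D F : E →L[ℝ] E} (hF : F = A - D)
    (hDF : ∀ v, D (F v) = F (D v)) {T : ℝ} (hT : 0 ≤ T) (M : ℝ) :
    ∃ C, 0 < C ∧ ∀ (x X y : ℝ → E) (p : ℝ → ℝ) (δ η I J g : ℝ),
      (∀ s, HasDerivAt x (F (x s)) s) → 0 ≤ δ →
      ContinuousOn X (Set.Icc 0 T) → MonotoneOn p (Set.Icc 0 T) →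
      (∀ s ∈ Set.Icc 0 T, p s ∈ Set.Icc 0 s) →
      (∀ s ∈ Set.Ico 0 T, ContinuousWithinAt p (Set.Ici s) s) →
      (∀ t ∈ Set.Icc 0 T,
        X t = x 0 + (∫ s in (0 : ℝ)..t, (A (X s) - D (X (p s)))) + y t) →
      (∀ t ∈ Set.Icc 0 T, ‖y t‖ ≤ η) →
      (∫ s in (0 : ℝ)..T, (s - p s)) ≤ I → (∫ s in (0 : ℝ)..T, (s - p s) ^ 2) ≤ J →
      (∀ t ∈ Set.Icc 0 T, |(∫ s in (0 : ℝ)..t, (s - p s)) - δ * M * t| ≤ g) →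
      ∀ t ∈ Set.Icc 0 T, ‖X t - x t - δ • ((M * t) • D (F (x t)))‖
        ≤ C * (η + ‖x 0‖ * (J + δ * I + g)) := by
  set e₀ : ℝ := 2 * Real.exp ((2 * ‖F‖ + 1) * T) with he₀
  have he₀0 : 0 < e₀ := by positivity
  set k₀ : ℝ := ‖F‖ * e₀ with hk₀
  set k₁ : ℝ := ‖F‖ ^ 2 * e₀ with hk₁
  set k₂ : ℝ := ‖D‖ * ‖F‖ * e₀ * (1 + T * ‖F‖) with hk₂
  set C₀ : ℝ := 1 + ‖D‖ * (k₀ + T * k₁ + k₁ + |M| * k₂) with hC₀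
  refine ⟨2 * C₀ * Real.exp ((2 * (‖A‖ + ‖D‖) + 1) * T), by positivity, ?_⟩
  intro x X y p δ η I J g hx hδ hX hp hpm hpr heq hy hI hJ hg
  have hAF : ∀ v, A v = F v + D v := by
    intro v
    simp [hF]
  have hxc : Continuous x := continuous_iff_continuousAt.2 fun s => (hx s).continuousAt
  have hxb : ∀ t ∈ Set.Icc 0 T, ‖x t‖ ≤ e₀ * ‖x 0‖ := norm_le_of_linear_ode hx
  set N : ℝ := ‖x 0‖ with hN
  have hN0 : 0 ≤ N := norm_nonneg _
  -- The correction `q` solves `q' = D F x + F q`, because `D` and `F` commute.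
  set q : ℝ → E := fun t => t • D (F (x t)) with hq
  have hqd : ∀ s, HasDerivAt q (D (F (x s)) + F (q s)) s := by
    intro s
    have h1 : HasDerivAt (fun t => D (F (x t))) (D (F (F (x s)))) s :=
      (D.comp F).hasFDerivAt.comp_hasDerivAt s (hx s)
    have h2 := (hasDerivAt_id s).smul h1
    convert! h2 using 1
    simp [hq, hDF, add_comm]
  have hqc : Continuous q := continuous_iff_continuousAt.2 fun s => (hqd s).continuousAt
  set Z : ℝ → E := fun t => x t + (δ * M) • q t with hZ
  have hZc : Continuous Z := hxc.add (hqc.const_smul _)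
  have hZd : ∀ s, HasDerivAt Z (F (Z s) + (δ * M) • D (F (x s))) s := by
    intro s
    convert! (hx s).add ((hqd s).const_smul (δ * M)) using 1
    simp only [hZ, map_add, map_smul, smul_add]
    abel
  have hFx : ∀ s ∈ Set.Icc 0 T, ‖F (x s)‖ ≤ k₀ * N := fun s hs =>
    (F.le_opNorm _).trans (by
      rw [hk₀, mul_assoc]
      gcongr
      exact hxb s hs)
  have hFFx : ∀ s ∈ Set.Icc 0 T, ‖F (F (x s))‖ ≤ k₁ * N := fun s hs =>
    (F.le_opNorm _).trans (by
      calc ‖F‖ * ‖F (x s)‖ ≤ ‖F‖ * (k₀ * N) := by gcongr; exact hFx s hs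
        _ = k₁ * N := by rw [hk₀, hk₁]; ring)
  have hDFx : ∀ s ∈ Set.Icc 0 T, ‖D (F (x s)) + F (q s)‖ ≤ k₂ * N := fun s hs => by
    have h1 : ‖D (F (x s))‖ ≤ ‖D‖ * (k₀ * N) :=
      (D.le_opNorm _).trans (by gcongr; exact hFx s hs)
    have h2 : ‖F (q s)‖ ≤ T * (‖F‖ * (‖D‖ * (k₀ * N))) := by
      simp only [hq, map_smul, norm_smul, Real.norm_eq_abs, abs_of_nonneg hs.1]
      have h3 : ‖F (D (F (x s)))‖ ≤ ‖F‖ * (‖D‖ * (k₀ * N)) :=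
        (F.le_opNorm _).trans (by gcongr)
      exact mul_le_mul hs.2 h3 (norm_nonneg _) hT
    refine (norm_add_le _ _).trans ((add_le_add h1 h2).trans (le_of_eq ?_))
    rw [hk₀, hk₂]
    ring
  have hpi : ∀ (f : ℝ → E), ContinuousOn f (Set.Icc 0 T) → ∀ t ∈ Set.Icc 0 T,
      IntervalIntegrable (fun s => f (p s)) volume 0 t := fun f hf t ht =>
    intervalIntegrable_comp_of_monotoneOn hf hp hpm ht
  have hΔi : ∀ t ∈ Set.Icc 0 T, IntervalIntegrable (fun s => s - p s) volume 0 t := fun t ht =>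
    continuous_id.intervalIntegrable _ _ |>.sub
      (intervalIntegrable_comp_of_monotoneOn (f := id) continuousOn_id hp hpm ht)
  have hΔ2i : ∀ t ∈ Set.Icc 0 T, IntervalIntegrable (fun s => (s - p s) ^ 2) volume 0 t := by
    intro t ht
    have h1 := intervalIntegrable_comp_of_monotoneOn (f := fun s => s ^ 2)
      (Continuous.continuousOn (by fun_prop)) hp hpm ht
    have h2 := (intervalIntegrable_comp_of_monotoneOn (f := id)
      continuousOn_id hp hpm ht).continuousOn_mul (continuousOn_id (s := Set.uIcc 0 t))
    have h3 : IntervalIntegrable (fun s : ℝ => s ^ 2) volume 0 t :=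
      Continuous.intervalIntegrable (by fun_prop) _ _
    refine ((h3.sub (h2.const_mul 2)).add h1).congr (fun s _ => ?_)
    simp only [id]
    ring
  have hXi : ∀ t ∈ Set.Icc 0 T, IntervalIntegrable (fun s => A (X s) - D (X (p s))) volume 0 t := by
    intro t ht
    refine IntervalIntegrable.sub (ContinuousOn.intervalIntegrable ?_)
      (hpi (fun v => D (X v)) (D.continuous.comp_continuousOn hX) t ht)
    rw [Set.uIcc_of_le ht.1]
    exact A.continuous.comp_continuousOn (hX.mono (Set.Icc_subset_Icc_right ht.2))
  have hZi : ∀ t ∈ Set.Icc 0 T, IntervalIntegrable (fun s => A (Z s) - D (Z (p s))) volume 0 t :=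
    fun t ht => ((A.continuous.comp hZc).intervalIntegrable _ _).sub
      (hpi (fun v => D (Z v)) (D.continuous.comp hZc).continuousOn t ht)
  have hI0 : ∀ t ∈ Set.Icc 0 T, ∫ s in (0 : ℝ)..t, (s - p s) ≤ I := fun t ht => by
    refine le_trans ?_ hI
    refine intervalIntegral.integral_mono_interval le_rfl ht.1 ht.2 ?_ (hΔi T ⟨hT, le_rfl⟩)
    filter_upwards [ae_restrict_mem measurableSet_Ioc] with s hs
    exact sub_nonneg.2 (hpm s ⟨hs.1.le, hs.2⟩).2
  have hJ0 : ∀ t ∈ Set.Icc 0 T, ∫ s in (0 : ℝ)..t, (s - p s) ^ 2 ≤ J := fun t ht => by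
    refine le_trans ?_ hJ
    refine intervalIntegral.integral_mono_interval le_rfl ht.1 ht.2 ?_ (hΔ2i T ⟨hT, le_rfl⟩)
    exact ae_of_all _ fun s => sq_nonneg _
  have hIn : 0 ≤ I := by simpa using hI0 0 ⟨le_rfl, hT⟩
  have hJn : 0 ≤ J := by simpa using hJ0 0 ⟨le_rfl, hT⟩
  have hgn : 0 ≤ g := (abs_nonneg _).trans (hg 0 ⟨le_rfl, hT⟩)
  have hηn : 0 ≤ η := (norm_nonneg _).trans (hy 0 ⟨le_rfl, hT⟩)
  -- The residual of `Z` is the integral of `D (R₁ + R₂)`: the oscillating part `R₁` is integrated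
  -- by parts, the Taylor remainder `R₂` is bounded in norm.
  set R₁ : ℝ → E := fun s => ((s - p s) - δ * M) • F (x s) with hR₁
  set R₂ : ℝ → E := fun s => (x s - x (p s) - (s - p s) • F (x s)) + (δ * M) • (q s - q (p s))
    with hR₂
  have hR₁i : ∀ t ∈ Set.Icc 0 T, IntervalIntegrable R₁ volume 0 t := fun t ht =>
    ((hΔi t ht).sub (continuous_const.intervalIntegrable _ _)).smul_continuousOn
      (F.continuous.comp hxc).continuousOn
  have hR₂i : ∀ t ∈ Set.Icc 0 T, IntervalIntegrable R₂ volume 0 t := fun t ht => by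
    refine IntervalIntegrable.add (IntervalIntegrable.sub ?_ ?_) ?_
    · exact (hxc.intervalIntegrable _ _).sub (hpi x hxc.continuousOn t ht)
    · exact (hΔi t ht).smul_continuousOn (F.continuous.comp hxc).continuousOn
    · exact ((hqc.intervalIntegrable _ _).sub (hpi q hqc.continuousOn t ht)).smul _
  have hsplit : ∀ s, A (Z s) - D (Z (p s)) - (F (Z s) + (δ * M) • D (F (x s)))
      = D (R₁ s + R₂ s) := by
    intro s
    have : R₁ s + R₂ s = Z s - Z (p s) - (δ * M) • F (x s) := by
      simp only [hR₁, hR₂, hZ, sub_smul, smul_sub]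
      abel
    rw [this, hAF]
    simp only [map_sub, map_smul]
    abel
  have hb₁ : ∀ t ∈ Set.Icc 0 T, ‖∫ s in (0 : ℝ)..t, R₁ s‖ ≤ g * (k₀ * N + T * (k₁ * N)) := by
    intro t ht
    refine norm_integral_smul_le (h := fun s => (s - p s) - δ * M) (g := fun s => F (x s))
      (g' := fun s => F (F (x s))) (T := T)
      (fun t ht => (hΔi t ht).sub (continuous_const.intervalIntegrable _ _))
      (fun s hs => (continuousWithinAt_id.sub (hpr s hs)).sub continuousWithinAt_const)
      (fun s => F.hasFDerivAt.comp_hasDerivAt s (hx s))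
      (F.continuous.comp (F.continuous.comp hxc)) hFx hFFx (fun t ht => ?_) ht
    rw [intervalIntegral.integral_sub (hΔi t ht) (continuous_const.intervalIntegrable _ _)]
    have := hg t ht
    rwa [intervalIntegral.integral_const, sub_zero, smul_eq_mul, mul_comm t]
  have hb₂ : ∀ t ∈ Set.Icc 0 T, ‖∫ s in (0 : ℝ)..t, R₂ s‖
      ≤ k₁ * N * J + δ * |M| * (k₂ * N) * I := by
    intro t ht
    have h1 : ‖∫ s in (0 : ℝ)..t, R₂ s‖ ≤ ∫ s in (0 : ℝ)..t,
        (k₁ * N * (s - p s) ^ 2 + δ * |M| * (k₂ * N) * (s - p s)) := by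
      refine intervalIntegral.norm_integral_le_of_norm_le ht.1 (ae_of_all _ fun s hs => ?_)
        (((hΔ2i t ht).const_mul _).add ((hΔi t ht).const_mul _))
      have hs' : s ∈ Set.Icc 0 T := ⟨hs.1.le, hs.2.trans ht.2⟩
      have hps := hpm s hs'
      have hsub : ∀ r ∈ Set.Icc (p s) s, r ∈ Set.Icc 0 T := fun r hr =>
        ⟨hps.1.trans hr.1, hr.2.trans hs'.2⟩
      refine (norm_add_le _ _).trans (add_le_add ?_ ?_)
      · refine (norm_sub_sub_smul_le hps.2 hx fun r hr => hxb r (hsub r hr)).trans (le_of_eq ?_)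
        rw [hk₁]
        ring
      · rw [norm_smul, norm_mul, Real.norm_eq_abs, Real.norm_eq_abs, abs_of_nonneg hδ,
          mul_assoc (δ * |M|)]
        exact mul_le_mul_of_nonneg_left
          (norm_sub_le_of_hasDerivAt hps.2 hqd fun r hr => hDFx r (hsub r hr)) (by positivity)
    refine h1.trans ?_
    rw [intervalIntegral.integral_add ((hΔ2i t ht).const_mul _) ((hΔi t ht).const_mul _),
      intervalIntegral.integral_const_mul, intervalIntegral.integral_const_mul]
    have := hI0 t ht
    have := hJ0 t ht
    gcongr
  set r : ℝ → E := fun t => y t + D (∫ s in (0 : ℝ)..t, (R₁ s + R₂ s)) with hr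
  have hrb : ∀ t ∈ Set.Icc 0 T, ‖r t‖ ≤ C₀ * (η + N * (J + δ * I + g)) := by
    intro t ht
    have h1 : ‖D (∫ s in (0 : ℝ)..t, (R₁ s + R₂ s))‖
        ≤ ‖D‖ * (g * (k₀ * N + T * (k₁ * N)) + (k₁ * N * J + δ * |M| * (k₂ * N) * I)) := by
      refine (D.le_opNorm _).trans ?_
      gcongr
      rw [intervalIntegral.integral_add (hR₁i t ht) (hR₂i t ht)]
      exact (norm_add_le _ _).trans (add_le_add (hb₁ t ht) (hb₂ t ht))
    have h2 := (norm_add_le (y t) _).trans (add_le_add (hy t ht) h1)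
    refine h2.trans ?_
    set a₁ : ℝ := ‖D‖ * (k₀ + T * k₁) with ha₁
    set a₂ : ℝ := ‖D‖ * k₁ with ha₂
    set a₃ : ℝ := ‖D‖ * (|M| * k₂) with ha₃
    have e1 : η + ‖D‖ * (g * (k₀ * N + T * (k₁ * N)) + (k₁ * N * J + δ * |M| * (k₂ * N) * I))
        = η + a₁ * (N * g) + a₂ * (N * J) + a₃ * (N * (δ * I)) := by
      rw [ha₁, ha₂, ha₃]
      ring
    have e2 : C₀ * (η + N * (J + δ * I + g))
        = (1 + a₁ + a₂ + a₃) * (η + N * g + N * J + N * (δ * I)) := by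
      rw [ha₁, ha₂, ha₃, hC₀]
      ring
    rw [e1, e2]
    have : 0 ≤ a₁ := by positivity
    have : 0 ≤ a₂ := by positivity
    have : 0 ≤ a₃ := by positivity
    have : 0 ≤ N * g := by positivity
    have : 0 ≤ N * J := by positivity
    have : 0 ≤ N * (δ * I) := by positivity
    generalize N * g = b₁ at *
    generalize N * J = b₂ at *
    generalize N * (δ * I) = b₃ at *
    have : 0 ≤ a₁ * (η + b₂ + b₃) + a₂ * (η + b₁ + b₃) + a₃ * (η + b₁ + b₂) + b₁ + b₂ + b₃ := by
      positivity
    linarith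
  intro t ht
  have hmain := norm_le_of_delayed_eq (A := A) (D := D) (u := fun t => X t - Z t) (r := r) (p := p)
    (T := T) (hX.sub hZc.continuousOn) hpm hrb (fun t ht => by
      have h1 : ∀ s, A (X s - Z s) - D (X (p s) - Z (p s))
          = (A (X s) - D (X (p s))) - (A (Z s) - D (Z (p s))) := by
        intro s
        simp only [map_sub]
        abel
      have hZ' : Continuous fun s => F (Z s) + (δ * M) • D (F (x s)) := by fun_prop
      have h2 := intervalIntegral.integral_eq_sub_of_hasDerivAt (a := 0) (b := t)
        (fun s _ => hZd s) (hZ'.intervalIntegrable _ _)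
      have h3 : D (∫ s in (0 : ℝ)..t, (R₁ s + R₂ s))
          = (∫ s in (0 : ℝ)..t, (A (Z s) - D (Z (p s)))) - (Z t - Z 0) := by
        rw [← D.intervalIntegral_comp_comm ((hR₁i t ht).add (hR₂i t ht)), ← h2,
          ← intervalIntegral.integral_sub (hZi t ht) (hZ'.intervalIntegrable _ _)]
        simp_rw [hsplit]
      have h4 : Z 0 = x 0 := by simp [hZ, hq]
      simp_rw [h1]
      rw [intervalIntegral.integral_sub (hXi t ht) (hZi t ht), hr]
      simp only [h3, h4]
      rw [heq t ht]
      abel) t ht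
  have hfin : X t - x t - δ • ((M * t) • D (F (x t))) = X t - Z t := by
    simp only [hZ, hq, smul_smul]
    rw [sub_sub, mul_assoc]
  rw [hfin]
  refine hmain.trans (le_of_eq ?_)
  ring

end Comparison

/-! ### The age of a renewal path -/

/-- `p` maps each time to the last point of the increasing sequence `a` before it. The times
start at `a 0 = 0` and do not accumulate. -/
structure IsLastPoint (a : ℕ → ℝ) (p : ℝ → ℝ) : Prop where
  zero : a 0 = 0
  strictMono : StrictMono a
  unbounded : ∀ t, ∃ k, t < a k
  eq : ∀ k, ∀ s ∈ Set.Ico (a k) (a (k + 1)), p s = a k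

namespace IsLastPoint

variable {a : ℕ → ℝ} {p : ℝ → ℝ}

theorem nonneg (h : IsLastPoint a p) (k : ℕ) : 0 ≤ a k :=
  h.zero ▸ h.strictMono.monotone (Nat.zero_le k)

theorem exists_mem_Ico (h : IsLastPoint a p) {s : ℝ} (hs : 0 ≤ s) :
    ∃ k, s ∈ Set.Ico (a k) (a (k + 1)) := by
  classical
  have hex := h.unbounded s
  obtain ⟨k, hk⟩ : ∃ k, Nat.find hex = k + 1 := Nat.exists_eq_succ_of_ne_zero fun h0 => by
    have := Nat.find_spec hex
    rw [h0, h.zero] at this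
    linarith
  refine ⟨k, not_lt.1 (Nat.find_min hex (by omega)), ?_⟩
  rw [← hk]
  exact Nat.find_spec hex

theorem mem_Icc (h : IsLastPoint a p) {s : ℝ} (hs : 0 ≤ s) : p s ∈ Set.Icc 0 s := by
  obtain ⟨k, hk⟩ := h.exists_mem_Ico hs
  rw [h.eq k s hk]
  exact ⟨h.nonneg k, hk.1⟩

theorem monotoneOn (h : IsLastPoint a p) : MonotoneOn p (Set.Ici 0) := by
  intro s hs t ht hst
  obtain ⟨k, hk⟩ := h.exists_mem_Ico hs
  obtain ⟨l, hl⟩ := h.exists_mem_Ico ht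
  rw [h.eq k s hk, h.eq l t hl]
  refine h.strictMono.monotone (Nat.lt_succ_iff.1 (h.strictMono.lt_iff_lt.1 ?_))
  exact hk.1.trans_lt (hst.trans_lt hl.2)

theorem continuousWithinAt (h : IsLastPoint a p) {s : ℝ} (hs : 0 ≤ s) :
    ContinuousWithinAt p (Set.Ici s) s := by
  obtain ⟨k, hk⟩ := h.exists_mem_Ico hs
  refine (continuousWithinAt_const (b := a k)).congr_of_eventuallyEq ?_ (h.eq k s hk)
  filter_upwards [Ico_mem_nhdsGE hk.2] with r hr using h.eq k r ⟨hk.1.trans hr.1, hr.2⟩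

theorem intervalIntegrable_pow_piece (h : IsLastPoint a p) (m : ℕ) {k : ℕ} {t : ℝ}
    (ht : t ∈ Set.Icc (a k) (a (k + 1))) :
    IntervalIntegrable (fun s => (s - p s) ^ m) volume (a k) t := by
  have h1 : IntervalIntegrable (fun s => (s - a k) ^ m) volume (a k) t :=
    Continuous.intervalIntegrable (by fun_prop) _ _
  refine h1.congr_uIoo fun s hs => ?_
  rw [Set.uIoo_of_le ht.1] at hs
  simp only [h.eq k s ⟨hs.1.le, hs.2.trans_le ht.2⟩]

theorem integral_pow_piece (h : IsLastPoint a p) (m : ℕ) {k : ℕ} {t : ℝ}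
    (ht : t ∈ Set.Icc (a k) (a (k + 1))) :
    ∫ s in a k..t, (s - p s) ^ m = (t - a k) ^ (m + 1) / (m + 1) := by
  have h1 : ∫ s in a k..t, (s - p s) ^ m = ∫ s in a k..t, (s - a k) ^ m := by
    refine intervalIntegral.integral_congr_uIoo fun s hs => ?_
    rw [Set.uIoo_of_le ht.1] at hs
    simp only [h.eq k s ⟨hs.1.le, hs.2.trans_le ht.2⟩]
  rw [h1, intervalIntegral.integral_comp_sub_right (fun s => s ^ m), integral_pow]
  simp

theorem integrable_and_integral_pow (h : IsLastPoint a p) (m k : ℕ) :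
    IntervalIntegrable (fun s => (s - p s) ^ m) volume 0 (a k) ∧
      ∫ s in (0 : ℝ)..a k, (s - p s) ^ m
        = ∑ i ∈ Finset.range k, (a (i + 1) - a i) ^ (m + 1) / (m + 1) := by
  induction k with
  | zero => simp [h.zero]
  | succ k ih =>
    have hk : a (k + 1) ∈ Set.Icc (a k) (a (k + 1)) :=
      ⟨(h.strictMono (Nat.lt_succ_self k)).le, le_rfl⟩
    refine ⟨ih.1.trans (h.intervalIntegrable_pow_piece m hk), ?_⟩
    rw [← intervalIntegral.integral_add_adjacent_intervals ih.1
      (h.intervalIntegrable_pow_piece m hk), ih.2, h.integral_pow_piece m hk,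
      Finset.sum_range_succ]

theorem integral_pow_le (h : IsLastPoint a p) (m : ℕ) {K : ℕ} {T : ℝ} (hT : 0 ≤ T)
    (hK : T ≤ a K) :
    ∫ s in (0 : ℝ)..T, (s - p s) ^ m
      ≤ ∑ i ∈ Finset.range K, (a (i + 1) - a i) ^ (m + 1) / (m + 1) := by
  obtain ⟨h1, h2⟩ := h.integrable_and_integral_pow m K
  rw [← h2]
  refine intervalIntegral.integral_mono_interval le_rfl hT hK ?_ h1
  filter_upwards [ae_restrict_mem measurableSet_Ioc] with s hs
  exact pow_nonneg (sub_nonneg.2 (h.mem_Icc hs.1.le).2) m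

/-- The integrated age differs from `c * t` by at most its deviation at the last renewal before
`t`, a partial sum, and a contribution of the current waiting time. -/
theorem exists_abs_integral_sub_le (h : IsLastPoint a p) {K : ℕ} {t c : ℝ} (hc : 0 ≤ c)
    (ht : 0 ≤ t) (hK : t < a K) :
    ∃ k < K, |(∫ s in (0 : ℝ)..t, (s - p s)) - c * t|
      ≤ |∑ i ∈ Finset.range k, ((a (i + 1) - a i) ^ 2 / 2 - c * (a (i + 1) - a i))|
        + ((a (k + 1) - a k) ^ 2 / 2 + c * (a (k + 1) - a k)) := by
  obtain ⟨k, hk⟩ := h.exists_mem_Ico ht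
  refine ⟨k, h.strictMono.lt_iff_lt.1 (hk.1.trans_lt hK), ?_⟩
  have hk' : t ∈ Set.Icc (a k) (a (k + 1)) := ⟨hk.1, hk.2.le⟩
  obtain ⟨h1, h2⟩ := h.integrable_and_integral_pow 1 k
  have h3 := intervalIntegral.integral_add_adjacent_intervals h1
    (h.intervalIntegrable_pow_piece 1 hk')
  rw [h2, h.integral_pow_piece 1 hk'] at h3
  simp only [pow_one, Nat.cast_one, one_add_one_eq_two] at h3
  have h4 : a k = ∑ i ∈ Finset.range k, (a (i + 1) - a i) := by
    rw [Finset.sum_range_sub, h.zero, sub_zero]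
  have h5 : (∫ s in (0 : ℝ)..t, (s - p s)) - c * t
      = ∑ i ∈ Finset.range k, ((a (i + 1) - a i) ^ 2 / 2 - c * (a (i + 1) - a i))
        + ((t - a k) ^ 2 / 2 - c * (t - a k)) := by
    rw [Finset.sum_sub_distrib, ← Finset.mul_sum, ← h4, ← h3]
    ring
  rw [h5]
  refine (abs_add_le _ _).trans ?_
  gcongr
  have h6 : 0 ≤ t - a k := sub_nonneg.2 hk.1
  have h7 : t - a k ≤ a (k + 1) - a k := by linarith [hk.2]
  have h8 : (t - a k) ^ 2 ≤ (a (k + 1) - a k) ^ 2 := by gcongr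
  have h9 : c * (t - a k) ≤ c * (a (k + 1) - a k) := by gcongr
  have h10 : 0 ≤ c * (t - a k) := mul_nonneg hc h6
  rw [abs_le]
  constructor <;> nlinarith [sq_nonneg (t - a k)]

end IsLastPoint

/-! ### Running maxima of partial sums -/

/-- The running maximum `max (0, z 0, z 0 + z 1, …)` over the first `k` partial sums. -/
noncomputable def runMax (z : ℕ → ℝ) : ℕ → ℝ
  | 0 => 0
  | k + 1 => max (runMax z k) (∑ i ∈ Finset.range (k + 1), z i)

theorem runMax_nonneg (z : ℕ → ℝ) (k : ℕ) : 0 ≤ runMax z k := by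
  induction k with
  | zero => exact le_rfl
  | succ k ih => exact ih.trans (le_max_left _ _)

theorem runMax_mono (z : ℕ → ℝ) : Monotone (runMax z) :=
  monotone_nat_of_le_succ fun _ => le_max_left _ _

theorem sum_le_runMax (z : ℕ → ℝ) {k K : ℕ} (h : k ≤ K) :
    ∑ i ∈ Finset.range k, z i ≤ runMax z K := by
  refine le_trans ?_ (runMax_mono z h)
  cases k with
  | zero => exact le_rfl
  | succ k => exact le_max_right _ _

theorem abs_sum_le_runMax (z : ℕ → ℝ) {k K : ℕ} (h : k ≤ K) :
    |∑ i ∈ Finset.range k, z i| ≤ runMax z K + runMax (fun i => -z i) K := by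
  have h1 := sum_le_runMax z h
  have h2 := sum_le_runMax (fun i => -z i) h
  rw [Finset.sum_neg_distrib] at h2
  rw [abs_le]
  constructor <;> linarith [runMax_nonneg z K, runMax_nonneg (fun i => -z i) K]

/-- The pathwise form of Doob's maximal inequality. For independent centred `z i` the last sum
has mean zero. -/
theorem sq_runMax_le (z : ℕ → ℝ) (k : ℕ) :
    runMax z k ^ 2 ≤ 4 * (∑ i ∈ Finset.range k, z i) ^ 2
      - 4 * ∑ i ∈ Finset.range k, runMax z i * z i := by
  have key : runMax z k ^ 2 / 2 + ∑ i ∈ Finset.range k, runMax z i * z i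
      ≤ runMax z k * ∑ i ∈ Finset.range k, z i := by
    induction k with
    | zero => simp [runMax]
    | succ k ih =>
      have hS := Finset.sum_range_succ z k
      rw [Finset.sum_range_succ (fun i => runMax z i * z i)]
      rcases le_total (∑ i ∈ Finset.range (k + 1), z i) (runMax z k) with h | h
      · rw [runMax, max_eq_left h, hS]
        linarith
      · rw [runMax, max_eq_right h]
        have hz : z k = ∑ i ∈ Finset.range (k + 1), z i - ∑ i ∈ Finset.range k, z i := by
          rw [hS]
          ring
        rw [hz]
        nlinarith [sq_nonneg (∑ i ∈ Finset.range (k + 1), z i - runMax z k)]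
  nlinarith [sq_nonneg (runMax z k - 2 * ∑ i ∈ Finset.range k, z i)]

section Maximal

variable {Ω : Type*} [MeasurableSpace Ω] {P : Measure Ω}

theorem measurable_runMax {z : ℕ → Ω → ℝ} {k : ℕ} (hz : ∀ i < k, Measurable (z i)) :
    Measurable fun ω => runMax (fun i => z i ω) k := by
  induction k with
  | zero => exact measurable_const
  | succ k ih =>
    refine (ih fun i hi => hz i (by omega)).max (Finset.measurable_fun_sum _ fun i hi => hz i ?_)
    simpa using hi

theorem memLp_runMax {z : ℕ → Ω → ℝ} (hz : ∀ i, MemLp (z i) 2 P) (k : ℕ) :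
    MemLp (fun ω => runMax (fun i => z i ω) k) 2 P := by
  induction k with
  | zero => exact MemLp.zero
  | succ k ih => exact ih.sup (memLp_finsetSum _ fun i _ => hz i)

theorem runMax_congr {z w : ℕ → ℝ} {k : ℕ} (h : ∀ i < k, z i = w i) : runMax z k = runMax w k := by
  induction k with
  | zero => rfl
  | succ k ih =>
    rw [runMax, runMax, ih fun i hi => h i (by omega),
      Finset.sum_congr rfl fun i hi => h i (Finset.mem_range.1 hi)]

/-- The running maximum up to `k` only depends on the variables before `k`. -/
theorem indepFun_runMax {z : ℕ → Ω → ℝ} (hz : ∀ i, Measurable (z i)) (hi : iIndepFun z P) (k : ℕ) :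
    IndepFun (fun ω => runMax (fun i => z i ω) k) (z k) P := by
  have h := hi.indepFun_finset (Finset.range k) {k} (by simp) hz
  let e : ℕ → (Finset.range k → ℝ) → ℝ := fun i v => if h : i ∈ Finset.range k then v ⟨i, h⟩ else 0
  have he : ∀ i, Measurable (e i) := by
    intro i
    by_cases h : i ∈ Finset.range k
    · simpa only [e, h, dite_true] using measurable_pi_apply _
    · simpa only [e, h, dite_false] using measurable_const
  have hψ : Measurable fun v : (({k} : Finset ℕ) → ℝ) => v ⟨k, Finset.mem_singleton_self k⟩ :=
    measurable_pi_apply _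
  have h2 := h.comp (measurable_runMax (k := k) fun i _ => he i) hψ
  convert! h2 using 1
  funext ω
  refine runMax_congr fun i hi => ?_
  simp [e, hi]

/-- Doob's `L²` maximal inequality for sums of independent centred variables. -/
theorem integral_sq_runMax_le [IsProbabilityMeasure P] {z : ℕ → Ω → ℝ}
    (hz : ∀ i, Measurable (z i)) (hi : iIndepFun z P) (h2 : ∀ i, MemLp (z i) 2 P)
    (h0 : ∀ i, ∫ ω, z i ω ∂P = 0) (k : ℕ) :
    ∫ ω, runMax (fun i => z i ω) k ^ 2 ∂P ≤ 4 * ∑ i ∈ Finset.range k, ∫ ω, z i ω ^ 2 ∂P := by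
  have hint : ∀ i, Integrable (fun ω => runMax (fun j => z j ω) i * z i ω) P := fun i =>
    (memLp_runMax h2 i).integrable_mul (h2 i)
  have hzero : ∀ i, ∫ ω, runMax (fun j => z j ω) i * z i ω ∂P = 0 := by
    intro i
    rw [(indepFun_runMax hz hi i).integral_fun_mul_eq_mul_integral
      (memLp_runMax h2 i).aestronglyMeasurable (h2 i).aestronglyMeasurable, h0, mul_zero]
  have hsum2 : MemLp (fun ω => ∑ i ∈ Finset.range k, z i ω) 2 P :=
    memLp_finsetSum _ fun i _ => h2 i
  have hvar : ∫ ω, (∑ i ∈ Finset.range k, z i ω) ^ 2 ∂P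
      = ∑ i ∈ Finset.range k, ∫ ω, z i ω ^ 2 ∂P := by
    have h := IndepFun.variance_sum (X := z) (s := Finset.range k) (μ := P) (fun i _ => h2 i)
      fun i _ j _ hij => hi.indepFun hij
    have hs : (∑ i ∈ Finset.range k, z i) = fun ω => ∑ i ∈ Finset.range k, z i ω := by
      funext ω
      simp
    rw [hs, variance_of_integral_eq_zero hsum2.aestronglyMeasurable.aemeasurable] at h
    · rw [h]
      exact Finset.sum_congr rfl fun i _ => variance_of_integral_eq_zero (hz i).aemeasurable (h0 i)
    · rw [integral_finsetSum _ fun i _ => (h2 i).integrable one_le_two]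
      exact Finset.sum_eq_zero fun i _ => h0 i
  have hI1 : Integrable (fun ω => 4 * (∑ i ∈ Finset.range k, z i ω) ^ 2) P :=
    hsum2.integrable_sq.const_mul 4
  have hI2 : Integrable
      (fun ω => 4 * ∑ i ∈ Finset.range k, runMax (fun j => z j ω) i * z i ω) P :=
    (integrable_finsetSum _ fun i _ => hint i).const_mul 4
  calc ∫ ω, runMax (fun i => z i ω) k ^ 2 ∂P
      ≤ ∫ ω, (4 * (∑ i ∈ Finset.range k, z i ω) ^ 2
          - 4 * ∑ i ∈ Finset.range k, runMax (fun j => z j ω) i * z i ω) ∂P :=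
        integral_mono (memLp_runMax h2 k).integrable_sq (hI1.sub hI2) fun ω => sq_runMax_le _ k
    _ = 4 * ∑ i ∈ Finset.range k, ∫ ω, z i ω ^ 2 ∂P := by
        rw [integral_sub hI1 hI2, integral_const_mul, integral_const_mul, hvar,
          integral_finsetSum _ fun i _ => hint i, Finset.sum_eq_zero fun i _ => hzero i]
        ring

end Maximal

/-! ### Waiting times -/

section Moments

variable {ν : Measure ℝ}

theorem integrable_exp_neg [IsFiniteMeasure ν] (hpos : ∀ᵐ y ∂ν, 0 < y) {r : ℝ} (hr : 0 ≤ r) :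
    Integrable (fun y => Real.exp (-r * y)) ν := by
  refine Integrable.of_bound (Measurable.aestronglyMeasurable (by fun_prop)) 1 ?_
  filter_upwards [hpos] with y hy
  rw [Real.norm_eq_abs, Real.abs_exp, Real.exp_le_one_iff]
  nlinarith

theorem integrable_pow_of_mgf [IsFiniteMeasure ν] (hpos : ∀ᵐ y ∂ν, 0 < y)
    (hmgf : ∃ r : ℝ, 0 < r ∧ Integrable (fun y => Real.exp (r * y)) ν) (k : ℕ) :
    Integrable (fun y => y ^ k) ν := by
  obtain ⟨r, hr, hint⟩ := hmgf
  exact integrable_pow_of_integrable_exp_mul (X := id) hr.ne' hint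
    (integrable_exp_neg hpos hr.le) k

theorem integral_pos_of_ae_pos [IsProbabilityMeasure ν] {f : ℝ → ℝ} (hf : ∀ᵐ y ∂ν, 0 < f y)
    (hint : Integrable f ν) : 0 < ∫ y, f y ∂ν := by
  rw [integral_pos_iff_support_of_nonneg_ae (hf.mono fun y hy => hy.le) hint]
  have h : ∀ᵐ y ∂ν, y ∈ Function.support f := hf.mono fun y hy => hy.ne'
  refine pos_iff_ne_zero.2 fun h0 => ?_
  obtain ⟨y, hy, hy'⟩ := (h.and (measure_eq_zero_iff_ae_notMem.1 h0)).exists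
  exact hy' hy

/-- The Laplace transform at `1` of a positive variable is less than `1`. -/
theorem integral_exp_neg_lt_one [IsProbabilityMeasure ν] (hpos : ∀ᵐ y ∂ν, 0 < y) :
    ∫ y, Real.exp (-1 * y) ∂ν < 1 := by
  have hint := integrable_exp_neg (ν := ν) hpos zero_le_one
  have h := integral_pos_of_ae_pos (ν := ν) (f := fun y => 1 - Real.exp (-1 * y)) (by
    filter_upwards [hpos] with y hy
    simpa using hy) ((integrable_const 1).sub hint)
  rw [integral_sub (integrable_const 1) hint] at h
  simpa using h

theorem meanAge_nonneg (hpos : ∀ᵐ y ∂ν, 0 < y) : 0 ≤ meanAge ν := by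
  have h : 0 ≤ ∫ y, y ∂ν := integral_nonneg_of_ae (hpos.mono fun y hy => hy.le)
  have h2 : 0 ≤ ∫ y, y ^ 2 ∂ν := integral_nonneg fun y => sq_nonneg y
  unfold meanAge
  positivity

/-- The constant `M` is chosen to centre `ξ ^ 2 / 2 - M * ξ`. -/
theorem integral_age_excess_eq_zero [IsProbabilityMeasure ν] (hpos : ∀ᵐ y ∂ν, 0 < y)
    (h1 : Integrable (fun y => y) ν) (h2 : Integrable (fun y => y ^ 2) ν) :
    ∫ y, (y ^ 2 / 2 - meanAge ν * y) ∂ν = 0 := by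
  have h := integral_pos_of_ae_pos hpos h1
  rw [integral_sub (h2.div_const 2) (h1.const_mul _), integral_div, integral_const_mul, meanAge]
  field_simp
  ring

end Moments

/-- Independent waiting times with common law `ν`. -/
structure IsWaitingTimes {Ω : Type*} [MeasurableSpace Ω] (ν : Measure ℝ) (ξ : ℕ → Ω → ℝ)
    (P : Measure Ω) : Prop where
  measurable : ∀ i, Measurable (ξ i)
  law : ∀ i, HasLaw (ξ i) ν P
  iindep : iIndepFun ξ P

namespace IsWaitingTimes

variable {Ω : Type*} [MeasurableSpace Ω] {ν : Measure ℝ} {ξ : ℕ → Ω → ℝ} {P : Measure Ω}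

theorem integrable_comp (h : IsWaitingTimes ν ξ P) {f : ℝ → ℝ} (hf : Integrable f ν) (i : ℕ) :
    Integrable (fun ω => f (ξ i ω)) P := by
  have h1 := (h.law i).map_eq
  rw [← h1] at hf
  exact (integrable_map_measure hf.aestronglyMeasurable (h.measurable i).aemeasurable).1 hf

theorem integral_comp (h : IsWaitingTimes ν ξ P) {f : ℝ → ℝ} (hf : Integrable f ν) (i : ℕ) :
    ∫ ω, f (ξ i ω) ∂P = ∫ y, f y ∂ν :=
  (h.law i).integral_comp hf.aestronglyMeasurable

theorem ae_pos (h : IsWaitingTimes ν ξ P) (hpos : ∀ᵐ y ∂ν, 0 < y) : ∀ᵐ ω ∂P, ∀ i, 0 < ξ i ω :=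
  ae_all_iff.2 fun i => ((h.law i).ae_iff (measurableSet_setOfPred.1 measurableSet_Ioi)).2 hpos

theorem integral_sum_comp (h : IsWaitingTimes ν ξ P) {f : ℝ → ℝ} (hf : Integrable f ν) (k : ℕ) :
    ∫ ω, ∑ i ∈ Finset.range k, f (ξ i ω) ∂P = k * ∫ y, f y ∂ν := by
  rw [integral_finsetSum _ fun i _ => h.integrable_comp hf i,
    Finset.sum_congr rfl fun i _ => h.integral_comp hf i]
  simp

/-- Chernoff's bound for the event that the `k`-th renewal comes early. -/
theorem measureReal_sum_le_le [IsProbabilityMeasure P] [IsFiniteMeasure ν]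
    (h : IsWaitingTimes ν ξ P) (hpos : ∀ᵐ y ∂ν, 0 < y) (k : ℕ) (L : ℝ) :
    P.real {ω | ∑ i ∈ Finset.range k, ξ i ω ≤ L}
      ≤ Real.exp L * (∫ y, Real.exp (-1 * y) ∂ν) ^ k := by
  have hint := integrable_exp_neg (ν := ν) hpos zero_le_one
  have h1 := measure_le_le_exp_mul_mgf (μ := P) (X := ∑ i ∈ Finset.range k, ξ i) (t := -1) L
    (by norm_num) (h.iindep.integrable_exp_mul_sum h.measurable fun i _ =>
      h.integrable_comp hint i)
  rw [h.iindep.mgf_sum h.measurable] at h1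
  have h2 : ∀ i, mgf (ξ i) P (-1) = ∫ y, Real.exp (-1 * y) ∂ν := fun i =>
    h.integral_comp hint i
  simp only [h2, Finset.prod_const, Finset.card_range, Finset.sum_apply, neg_neg, one_mul] at h1
  simpa using h1

theorem ae_unbounded [IsProbabilityMeasure P] [IsProbabilityMeasure ν]
    (h : IsWaitingTimes ν ξ P) (hpos : ∀ᵐ y ∂ν, 0 < y) :
    ∀ᵐ ω ∂P, ∀ t : ℝ, ∃ k, t < ∑ i ∈ Finset.range k, ξ i ω := by
  have h1 : ∀ L : ℕ, ∀ᵐ ω ∂P, ∃ k, (L : ℝ) < ∑ i ∈ Finset.range k, ξ i ω := by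
    intro L
    have hlim : Tendsto (fun k : ℕ => Real.exp L * (∫ y, Real.exp (-1 * y) ∂ν) ^ k) atTop
        (𝓝 0) := by
      have := tendsto_pow_atTop_nhds_zero_of_lt_one
        (integral_nonneg fun y => (Real.exp_pos (-1 * y)).le) (integral_exp_neg_lt_one hpos)
      simpa using this.const_mul (Real.exp L)
    have h2 : P.real {ω | ¬ ∃ k, (L : ℝ) < ∑ i ∈ Finset.range k, ξ i ω} ≤ 0 := by
      refine ge_of_tendsto' hlim fun k => ?_
      refine le_trans (measureReal_mono fun ω hω => ?_) (h.measureReal_sum_le_le hpos k L)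
      simp only [Set.mem_ofPred_eq, not_exists, not_lt] at hω
      exact hω k
    rw [ae_iff]
    exact (measureReal_eq_zero_iff).1 (le_antisymm h2 measureReal_nonneg)
  filter_upwards [ae_all_iff.2 h1] with ω hω t
  obtain ⟨L, hL⟩ := exists_nat_gt t
  obtain ⟨k, hk⟩ := hω L
  exact ⟨k, hL.trans hk⟩

end IsWaitingTimes

/-- Almost surely the sampling times increase to infinity, so the supremum that defines the renewal
process is attained. -/
theorem isLastPoint_lastSample {Ω : Type u} {ξ : ℕ → Ω → ℝ} {n : ℕ} (hn : 0 < n) {ω : Ω}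
    (hpos : ∀ i, 0 < ξ i ω) (hunb : ∀ t : ℝ, ∃ k, t < ∑ i ∈ Finset.range k, ξ i ω) :
    IsLastPoint (fun k => sampleTime ξ n k ω) (fun t => lastSample ξ n t ω) := by
  have hn' : (0 : ℝ) < n := by exact_mod_cast hn
  have hmono : StrictMono fun k => sampleTime ξ n k ω := by
    refine strictMono_nat_of_lt_succ fun k => ?_
    simp only [sampleTime, Finset.sum_range_succ]
    have := div_pos (hpos k) hn'
    linarith
  refine ⟨by simp [sampleTime], hmono, fun t => ?_, fun k s hs => ?_⟩
  · obtain ⟨k, hk⟩ := hunb (t * n)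
    refine ⟨k, ?_⟩
    simp only [sampleTime]
    rwa [← Finset.sum_div, lt_div_iff₀ hn']
  · have hset : {j : ℕ | sampleTime ξ n j ω ≤ s} = Set.Iic k := by
      ext j
      simp only [Set.mem_ofPred_eq, Set.mem_Iic]
      constructor
      · intro hj
        exact Nat.lt_succ_iff.1 (hmono.lt_iff_lt.1 (hj.trans_lt hs.2))
      · intro hj
        exact (hmono.monotone hj).trans hs.1
    rw [lastSample, renewalCount, hset, csSup_Iic]

/-! ### The mean of the integrated age -/

theorem le_sq_div_add {b : ℝ} (hb : 0 < b) (x : ℝ) : x ≤ x ^ 2 / b + b := by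
  have : x ^ 2 / b + b - x = (x ^ 2 - x * b + b ^ 2) / b := by
    field_simp
    ring
  have h2 : 0 ≤ (x ^ 2 - x * b + b ^ 2) / b :=
    div_nonneg (by nlinarith [sq_nonneg (x - b), sq_nonneg x, sq_nonneg b]) hb.le
  linarith

namespace IsLastPoint

variable {a : ℕ → ℝ} {p : ℝ → ℝ}

/-- The trivial bounds on the integrated age, for paths that have few renewals before `T`. -/
theorem abs_integral_pow_le (h : IsLastPoint a p) (m : ℕ) {t T : ℝ} (ht : t ∈ Set.Icc 0 T) :
    |∫ s in (0 : ℝ)..t, (s - p s) ^ m| ≤ T ^ m * T := by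
  have hT : 0 ≤ T := ht.1.trans ht.2
  have h1 : ‖∫ s in (0 : ℝ)..t, (s - p s) ^ m‖ ≤ T ^ m * |t - 0| := by
    refine intervalIntegral.norm_integral_le_of_norm_le_const fun s hs => ?_
    rw [Set.uIoc_of_le ht.1] at hs
    have hp := h.mem_Icc hs.1.le
    have h0 : 0 ≤ s - p s := sub_nonneg.2 hp.2
    rw [norm_pow, Real.norm_eq_abs, abs_of_nonneg h0]
    gcongr
    linarith [hp.1, hs.2, ht.2]
  rw [sub_zero, abs_of_nonneg ht.1] at h1
  exact h1.trans (by gcongr; exact ht.2)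

/-- Bounds on the integrated age in terms of sums over the first `K` scaled waiting times
`δ * w i`, for paths whose `K`-th renewal is after `T`. The squares appear because only second
moments of running maxima are controlled; `b` balances them. -/
theorem age_bounds (h : IsLastPoint a p) {w : ℕ → ℝ} (hw : ∀ i, 0 < w i) {δ M b T : ℝ} {K : ℕ}
    (hδ : 0 < δ) (hM : 0 ≤ M) (hb : 0 < b) (ha : ∀ k, a (k + 1) - a k = δ * w k) (hT : 0 ≤ T)
    (hK : T < a K) :
    (∫ s in (0 : ℝ)..T, (s - p s)) ≤ δ ^ 2 * ∑ i ∈ Finset.range K, w i ^ 2 ∧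
    (∫ s in (0 : ℝ)..T, (s - p s) ^ 2) ≤ δ ^ 3 * ∑ i ∈ Finset.range K, w i ^ 3 ∧
    ∀ t ∈ Set.Icc 0 T, |(∫ s in (0 : ℝ)..t, (s - p s)) - δ * M * t| ≤
      δ ^ 2 * ((runMax (fun i => w i ^ 2 / 2 - M * w i) K ^ 2
        + runMax (fun i => -(w i ^ 2 / 2 - M * w i)) K ^ 2
        + ∑ i ∈ Finset.range K, (w i ^ 2 / 2 + M * w i) ^ 2) / b + 3 * b) := by
  refine ⟨?_, ?_, fun t ht => ?_⟩
  · have h1 := h.integral_pow_le 1 hT hK.le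
    simp only [pow_one, ha] at h1
    refine h1.trans ?_
    rw [Finset.mul_sum]
    refine Finset.sum_le_sum fun i _ => ?_
    have := mul_pos (pow_pos hδ 2) (pow_pos (hw i) 2)
    rw [mul_pow]
    norm_num
    linarith
  · have h1 := h.integral_pow_le 2 hT hK.le
    simp only [ha] at h1
    refine h1.trans ?_
    rw [Finset.mul_sum]
    refine Finset.sum_le_sum fun i _ => ?_
    have := mul_pos (pow_pos hδ 3) (pow_pos (hw i) 3)
    rw [mul_pow]
    norm_num
    linarith
  · obtain ⟨k, hk, hle⟩ := h.exists_abs_integral_sub_le (c := δ * M) (by positivity) ht.1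
      (ht.2.trans_lt hK)
    refine hle.trans ?_
    simp only [ha]
    have e1 : ∀ i, (δ * w i) ^ 2 / 2 - δ * M * (δ * w i) = δ ^ 2 * (w i ^ 2 / 2 - M * w i) := by
      intro i
      ring
    have e2 : (δ * w k) ^ 2 / 2 + δ * M * (δ * w k) = δ ^ 2 * (w k ^ 2 / 2 + M * w k) := by ring
    simp only [e1, e2]
    rw [← Finset.mul_sum, abs_mul, abs_of_pos (pow_pos hδ 2), ← mul_add]
    have h1 := abs_sum_le_runMax (fun i => w i ^ 2 / 2 - M * w i) hk.le
    set r₁ := runMax (fun i => w i ^ 2 / 2 - M * w i) K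
    set r₂ := runMax (fun i => -(w i ^ 2 / 2 - M * w i)) K
    have h2 := le_sq_div_add hb r₁
    have h3 := le_sq_div_add hb r₂
    have h4 := le_sq_div_add hb (w k ^ 2 / 2 + M * w k)
    have h5 : (w k ^ 2 / 2 + M * w k) ^ 2 / b
        ≤ (∑ i ∈ Finset.range K, (w i ^ 2 / 2 + M * w i) ^ 2) / b := by
      gcongr
      exact Finset.single_le_sum (f := fun i => (w i ^ 2 / 2 + M * w i) ^ 2)
        (fun i _ => sq_nonneg _) (Finset.mem_range.2 hk)
    refine mul_le_mul_of_nonneg_left ?_ (pow_pos hδ 2).le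
    rw [add_div, add_div]
    linarith

end IsLastPoint

/-- With `n` renewals per unit of time, the integrals of the squared age, of the age divided by `n`,
and the deviation of the integrated age from `M * t / n` are dominated by a variable whose mean is
of order `n ^ (-3 / 2)`. The number of renewals before `T` is at most `c * n` outside of an event
of probability `exp (-n)`, on which the trivial bounds suffice. -/
theorem exists_age_error {ν : Measure ℝ} [IsProbabilityMeasure ν] (hpos : ∀ᵐ y ∂ν, 0 < y)
    (hmgf : ∃ r : ℝ, 0 < r ∧ Integrable (fun y => Real.exp (r * y)) ν) {T : ℝ} (hT : 0 < T) :
    ∃ C, 0 < C ∧ ∀ (Ω : Type u) [MeasurableSpace Ω] (P : Measure Ω) [IsProbabilityMeasure P]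
      (ξ : ℕ → Ω → ℝ), IsWaitingTimes ν ξ P → ∀ n : ℕ, 0 < n → ∃ Y : Ω → ℝ,
        Measurable Y ∧ ∫⁻ ω, ENNReal.ofReal (Y ω) ∂P ≤ ENNReal.ofReal (C * (√n / n ^ 2)) ∧
        ∀ᵐ ω ∂P, IsLastPoint (fun k => sampleTime ξ n k ω) (fun t => lastSample ξ n t ω) ∧
          ∃ I J g : ℝ, (∫ s in (0 : ℝ)..T, (s - lastSample ξ n s ω)) ≤ I ∧
            (∫ s in (0 : ℝ)..T, (s - lastSample ξ n s ω) ^ 2) ≤ J ∧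
            (∀ t ∈ Set.Icc 0 T, |(∫ s in (0 : ℝ)..t, (s - lastSample ξ n s ω))
              - 1 / n * meanAge ν * t| ≤ g) ∧
            J + 1 / n * I + g ≤ Y ω := by
  set M := meanAge ν with hMdef
  have hM : 0 ≤ M := meanAge_nonneg hpos
  have hmom := integrable_pow_of_mgf hpos hmgf
  set ρ := ∫ y, Real.exp (-1 * y) ∂ν with hρ
  have hρ0 : 0 ≤ ρ := integral_nonneg fun y => (Real.exp_pos _).le
  -- `c` makes the Chernoff bound `(exp T * ρ ^ c) ^ n` at most `exp (-n)`.
  obtain ⟨c, hc⟩ := exists_pow_lt_of_lt_one (Real.exp_pos (-T - 1)) (integral_exp_neg_lt_one hpos)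
  -- Second moments of the centred excess and of the bound for the current waiting time.
  have hexc : Integrable (fun y : ℝ => y ^ 2 / 2 - M * y) ν := by
    have h1 := hmom 1
    simp only [pow_one] at h1
    exact ((hmom 2).div_const 2).sub (h1.const_mul M)
  have hexc2 : Integrable (fun y : ℝ => (y ^ 2 / 2 - M * y) ^ 2) ν := by
    refine ((((hmom 4).div_const 4).sub ((hmom 3).const_mul M)).add
      ((hmom 2).const_mul (M ^ 2))).congr (ae_of_all _ fun y => ?_)
    simp only [Pi.add_apply, Pi.sub_apply]
    ring
  have hsng2 : Integrable (fun y : ℝ => (y ^ 2 / 2 + M * y) ^ 2) ν := by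
    refine ((((hmom 4).div_const 4).add ((hmom 3).const_mul M)).add
      ((hmom 2).const_mul (M ^ 2))).congr (ae_of_all _ fun y => ?_)
    simp only [Pi.add_apply]
    ring
  set v := ∫ y, (y ^ 2 / 2 - M * y) ^ 2 ∂ν with hv
  set q := ∫ y, (y ^ 2 / 2 + M * y) ^ 2 ∂ν with hq
  set m₂ := ∫ y, y ^ 2 ∂ν with hm₂
  set m₃ := ∫ y, y ^ 3 ∂ν with hm₃
  have hv0 : 0 ≤ v := integral_nonneg fun y => sq_nonneg _
  have hq0 : 0 ≤ q := integral_nonneg fun y => sq_nonneg _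
  have hm₂0 : 0 ≤ m₂ := integral_nonneg fun y => sq_nonneg _
  have hm₃0 : 0 ≤ m₃ := integral_nonneg_of_ae (hpos.mono fun y hy => (pow_pos hy 3).le)
  set B := T ^ 2 * T + T * T + (T * T + M * T) with hB
  have hB0 : 0 < B := by positivity
  refine ⟨(8 * c * v + c * q + 3) + c * (m₂ + m₃) + 2 * B, by positivity, ?_⟩
  intro Ω _ P _ ξ hξ n hn
  have hn0 : (0 : ℝ) < n := by exact_mod_cast hn
  have hn1 : (1 : ℝ) ≤ n := by exact_mod_cast hn
  set δ : ℝ := 1 / n with hδ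
  have hδ0 : 0 < δ := by positivity
  have hδ1 : δ ≤ 1 := by rw [hδ, div_le_one hn0]; exact hn1
  set b : ℝ := √n with hb
  have hb0 : 0 < b := Real.sqrt_pos.2 hn0
  have hb1 : 1 ≤ b := Real.one_le_sqrt.2 hn1
  have hbb : b ^ 2 = n := Real.sq_sqrt hn0.le
  set K := c * n with hK
  set z : ℕ → Ω → ℝ := fun i ω => ξ i ω ^ 2 / 2 - M * ξ i ω with hz
  have hzm : ∀ i, Measurable (z i) := fun i => by
    have := hξ.measurable i
    fun_prop
  have hzind : iIndepFun z P := hξ.iindep.comp (fun _ y => y ^ 2 / 2 - M * y)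
    fun _ => by fun_prop
  have hz2 : ∀ i, MemLp (z i) 2 P := fun i =>
    (memLp_two_iff_integrable_sq (hzm i).aestronglyMeasurable).2 (hξ.integrable_comp hexc2 i)
  have hz0 : ∀ i, ∫ ω, z i ω ∂P = 0 := fun i => by
    have h1 : Integrable (fun y : ℝ => y) ν := by simpa using hmom 1
    exact (hξ.integral_comp hexc i).trans (integral_age_excess_eq_zero hpos h1 (hmom 2))
  have hzs : ∀ i, ∫ ω, z i ω ^ 2 ∂P = v := fun i => hξ.integral_comp hexc2 i
  set w : ℕ → Ω → ℝ := fun i ω => -z i ω with hw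
  have hwm : ∀ i, Measurable (w i) := fun i => (hzm i).neg
  have hw2 : ∀ i, MemLp (w i) 2 P := fun i => (hz2 i).neg
  have hwind : iIndepFun w P := hzind.comp (fun _ y => -y) fun _ => by fun_prop
  have hr₁ := integral_sq_runMax_le hzm hzind hz2 hz0 K
  have hr₂ := integral_sq_runMax_le hwm hwind hw2
    (fun i => by simp only [hw]; rw [integral_neg, hz0, neg_zero]) K
  simp only [hw, neg_sq, hzs, Finset.sum_const, Finset.card_range, nsmul_eq_mul] at hr₁ hr₂
  have hr₁i := (memLp_runMax hz2 K).integrable_sq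
  have hr₂i := (memLp_runMax hw2 K).integrable_sq
  set bad : Set Ω := {ω | ∑ i ∈ Finset.range K, ξ i ω ≤ n * T} with hbad
  have hbadm : MeasurableSet bad :=
    measurableSet_le (Finset.measurable_fun_sum _ fun i _ => hξ.measurable i) measurable_const
  have hbadP : P.real bad ≤ 2 * δ ^ 2 := by
    refine (hξ.measureReal_sum_le_le hpos K (n * T)).trans ?_
    have h1 : Real.exp (n * T) * ρ ^ K ≤ Real.exp (-(n : ℝ)) := by
      calc Real.exp (n * T) * ρ ^ K = (Real.exp T * ρ ^ c) ^ n := by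
            rw [Real.exp_nat_mul, hK, pow_mul, mul_pow]
        _ ≤ (Real.exp T * Real.exp (-T - 1)) ^ n := by gcongr
        _ = Real.exp (-(n : ℝ)) := by
            rw [← Real.exp_add, ← Real.exp_nat_mul]
            congr 1
            ring
    refine h1.trans ?_
    have h2 := Real.quadratic_le_exp_of_nonneg hn0.le
    have h3 : (n : ℝ) ^ 2 / 2 ≤ Real.exp n := by linarith
    rw [Real.exp_neg, hδ, inv_le_comm₀ (Real.exp_pos _) (by positivity)]
    refine le_trans (le_of_eq ?_) h3
    field_simp
  -- `f₁` bounds the deviation, `f₂` the integrated powers of the age, `f₃` pays for the bad event.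
  set f₁ : Ω → ℝ := fun ω => δ ^ 2 * ((runMax (fun i => z i ω) K ^ 2
    + runMax (fun i => w i ω) K ^ 2
    + ∑ i ∈ Finset.range K, (ξ i ω ^ 2 / 2 + M * ξ i ω) ^ 2) / b + 3 * b) with hf₁
  set f₂ : Ω → ℝ := fun ω => δ ^ 3 * (∑ i ∈ Finset.range K, ξ i ω ^ 2
    + ∑ i ∈ Finset.range K, ξ i ω ^ 3) with hf₂
  set f₃ : Ω → ℝ := bad.indicator fun _ => B with hf₃
  have hξm := hξ.measurable
  have hsumi : ∀ f : ℝ → ℝ, Integrable f ν →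
      Integrable (fun ω => ∑ i ∈ Finset.range K, f (ξ i ω)) P := fun f hf =>
    integrable_finsetSum _ fun i _ => hξ.integrable_comp hf i
  have hi₂ : Integrable (fun ω => runMax (fun i => z i ω) K ^ 2
      + runMax (fun i => w i ω) K ^ 2) P := hr₁i.add hr₂i
  have hi₃ : Integrable (fun ω => (runMax (fun i => z i ω) K ^ 2 + runMax (fun i => w i ω) K ^ 2
      + ∑ i ∈ Finset.range K, (ξ i ω ^ 2 / 2 + M * ξ i ω) ^ 2) / b) P :=
    (hi₂.add (hsumi _ hsng2)).div_const b
  have hf₁i : Integrable f₁ P := (hi₃.add (integrable_const _)).const_mul _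
  have hf₂i : Integrable f₂ P := ((hsumi _ (hmom 2)).add (hsumi _ (hmom 3))).const_mul _
  have hf₃i : Integrable f₃ P := (integrable_const B).indicator hbadm
  have hE₁ : ∫ ω, f₁ ω ∂P ≤ δ ^ 2 * ((4 * (K * v) + 4 * (K * v) + K * q) / b + 3 * b) := by
    have h1 : ∫ ω, f₁ ω ∂P = δ ^ 2 * ((∫ ω, runMax (fun i => z i ω) K ^ 2 ∂P
        + ∫ ω, runMax (fun i => w i ω) K ^ 2 ∂P + K * q) / b + 3 * b) := by
      rw [hf₁, integral_const_mul, integral_add hi₃ (integrable_const _), integral_div,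
        integral_add hi₂ (hsumi _ hsng2), integral_add hr₁i hr₂i,
        hξ.integral_sum_comp hsng2, ← hq]
      simp
    rw [h1]
    gcongr
  have hE₂ : ∫ ω, f₂ ω ∂P = δ ^ 3 * (K * m₂ + K * m₃) := by
    rw [hf₂, integral_const_mul, integral_add (hsumi _ (hmom 2)) (hsumi _ (hmom 3)),
      hξ.integral_sum_comp (hmom 2), hξ.integral_sum_comp (hmom 3)]
  have hE₃ : ∫ ω, f₃ ω ∂P ≤ 2 * δ ^ 2 * B := by
    rw [hf₃, integral_indicator_const _ hbadm, smul_eq_mul]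
    gcongr
  have hf₁n : ∀ ω, 0 ≤ f₁ ω := fun ω => by positivity
  have hf₃n : ∀ ω, 0 ≤ f₃ ω := fun ω => Set.indicator_nonneg (fun _ _ => hB0.le) ω
  have hf₂n : ∀ ω, (∀ i, 0 < ξ i ω) → 0 ≤ f₂ ω := fun ω hω => by
    have : ∀ i, 0 ≤ ξ i ω := fun i => (hω i).le
    have := fun k : ℕ => Finset.sum_nonneg fun i (_ : i ∈ Finset.range K) => pow_nonneg (this i) k
    exact mul_nonneg (by positivity) (add_nonneg (this 2) (this 3))
  have hξpos := hξ.ae_pos hpos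
  refine ⟨fun ω => f₁ ω + f₂ ω + f₃ ω, ?_, ?_, ?_⟩
  · have h1 : Measurable fun ω => runMax (fun i => z i ω) K := measurable_runMax fun i _ => hzm i
    have h2 : Measurable fun ω => runMax (fun i => w i ω) K := measurable_runMax fun i _ => hwm i
    have h3 : Measurable f₃ := measurable_const.indicator hbadm
    have h4 : Measurable f₁ := by fun_prop
    have h5 : Measurable f₂ := by fun_prop
    exact (h4.add h5).add h3
  · have hf₁₂i : Integrable (fun ω => f₁ ω + f₂ ω) P := hf₁i.add hf₂i
    have hfi : Integrable (fun ω => f₁ ω + f₂ ω + f₃ ω) P := hf₁₂i.add hf₃i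
    rw [← ofReal_integral_eq_lintegral_ofReal hfi (by
      filter_upwards [hξpos] with ω hω
      exact add_nonneg (add_nonneg (hf₁n ω) (hf₂n ω hω)) (hf₃n ω))]
    refine ENNReal.ofReal_le_ofReal ?_
    rw [integral_add hf₁₂i hf₃i, integral_add hf₁i hf₂i, hE₂]
    have hKn : (K : ℝ) = c * n := by rw [hK]; push_cast; ring
    have hx : √n / (n : ℝ) ^ 2 = δ ^ 2 * b := by rw [hδ, ← hb]; field_simp
    have hδn : δ * n = 1 := by rw [hδ]; field_simp
    have e1 : δ ^ 2 * ((4 * (K * v) + 4 * (K * v) + K * q) / b + 3 * b)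
        = (8 * c * v + c * q + 3) * (δ ^ 2 * b) := by
      rw [hKn, ← hbb]
      field_simp
      ring
    have e2 : δ ^ 3 * (K * m₂ + K * m₃) = c * (m₂ + m₃) * δ ^ 2 := by
      rw [hKn]
      linear_combination (c * (m₂ + m₃) * δ ^ 2) * hδn
    have h1 : δ ^ 2 ≤ δ ^ 2 * b := le_mul_of_one_le_right (by positivity) hb1
    have h2 : c * (m₂ + m₃) * δ ^ 2 ≤ c * (m₂ + m₃) * (δ ^ 2 * b) := by gcongr
    have h3 : 2 * δ ^ 2 * B ≤ 2 * B * (δ ^ 2 * b) := by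
      calc 2 * δ ^ 2 * B = 2 * B * δ ^ 2 := by ring
        _ ≤ _ := by gcongr
    rw [hx, e2]
    linarith [hE₁.trans_eq e1]
  · filter_upwards [hξpos, hξ.ae_unbounded hpos] with ω hω hunb
    have hlp := isLastPoint_lastSample hn hω hunb
    refine ⟨hlp, ?_⟩
    by_cases hωbad : ω ∈ bad
    · refine ⟨T * T, T ^ 2 * T, T * T + M * T, ?_, ?_, fun t ht => ?_, ?_⟩
      · have := hlp.abs_integral_pow_le 1 (t := T) (T := T) ⟨hT.le, le_rfl⟩
        simp only [pow_one] at this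
        exact (le_abs_self _).trans this
      · exact (le_abs_self _).trans (hlp.abs_integral_pow_le 2 (t := T) (T := T) ⟨hT.le, le_rfl⟩)
      · have := hlp.abs_integral_pow_le 1 ht
        simp only [pow_one] at this
        refine (abs_sub _ _).trans (add_le_add this ?_)
        rw [abs_of_nonneg (mul_nonneg (by positivity) ht.1)]
        calc δ * M * t ≤ 1 * M * T := by
              have := ht.1
              have := ht.2
              gcongr
          _ = M * T := by ring
      · have h1 : f₃ ω = B := Set.indicator_of_mem hωbad _
        have h2 : δ * (T * T) ≤ 1 * (T * T) := by gcongr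
        have h3 := hf₁n ω
        have h4 := hf₂n ω hω
        simp only [h1, hB]
        linarith
    · have hKT : T < sampleTime ξ n K ω := by
        simp only [hbad, Set.mem_ofPred_eq, not_le] at hωbad
        simp only [sampleTime]
        rw [← Finset.sum_div, lt_div_iff₀ hn0, mul_comm]
        exact hωbad
      obtain ⟨h1, h2, h3⟩ := hlp.age_bounds (w := fun i => ξ i ω) (δ := δ) (M := M) (b := b)
        (K := K) hω hδ0 hM hb0 (fun k => by
          simp only [sampleTime, Finset.sum_range_succ, hδ]
          ring) hT.le hKT
      refine ⟨_, _, _, h1, h2, h3, ?_⟩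
      have h4 : f₃ ω = 0 := Set.indicator_of_notMem hωbad _
      simp only [h4, hf₁, hf₂, hz, hw]
      refine le_of_eq ?_
      ring

/-! ### The maximum of Brownian motion -/

/-- The increments of `B` over a partition of `[0, T]` into `N` equal pieces. -/
noncomputable def gridIncrement {Ω : Type*} (B : ℝ≥0 → Ω → ℝ) (T : ℝ≥0) (N i : ℕ)
    (ω : Ω) : ℝ :=
  B (T * ((i + 1 : ℕ) / N)) ω - B (T * (i / N)) ω

theorem sum_gridIncrement {Ω : Type*} (B : ℝ≥0 → Ω → ℝ) (T : ℝ≥0) (N k : ℕ) (ω : Ω) :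
    ∑ i ∈ Finset.range k, gridIncrement B T N i ω = B (T * (k / N)) ω - B 0 ω := by
  simp only [gridIncrement]
  rw [Finset.sum_range_sub fun i => B (T * ((i : ℕ) / N)) ω]
  simp

section Brownian

variable {Ω : Type*} [MeasurableSpace Ω] {P : Measure Ω}

theorem integral_sq_runMax_gridIncrement_le [IsProbabilityMeasure P] {B : ℝ≥0 → Ω → ℝ}
    (hm : ∀ t, Measurable (B t)) (hB : IsPreBrownianReal B P) (T : ℝ≥0) {N : ℕ} (hN : 0 < N) :
    Integrable (fun ω => runMax (fun i => gridIncrement B T N i ω) N ^ 2) P ∧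
      ∫ ω, runMax (fun i => gridIncrement B T N i ω) N ^ 2 ∂P ≤ 4 * T := by
  have hN0 : (0 : ℝ) < N := by exact_mod_cast hN
  have hzm : ∀ i, Measurable (gridIncrement B T N i) := fun i => (hm _).sub (hm _)
  have hmono : Monotone fun i : ℕ => T * ((i : ℝ≥0) / N) := fun i j hij => by
    simp only
    gcongr
  have hind : iIndepFun (gridIncrement B T N) P := hB.hasIndepIncrements.nat hmono
  have hlaw : ∀ i, HasLaw (gridIncrement B T N i) (gaussianReal 0 (T / N)) P := fun i => by
    have h := hB.hasLaw_sub (T * ((i + 1 : ℕ) / N)) (T * (i / N))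
    have e : nndist (T * ((i + 1 : ℕ) / N) : ℝ≥0).1 (T * (i / N) : ℝ≥0).1 = T / N := by
      rw [← NNReal.coe_inj, coe_nndist, Real.dist_eq]
      have : ((T * ((i + 1 : ℕ) / N) : ℝ≥0) : ℝ) - ((T * (i / N) : ℝ≥0) : ℝ) = T / N := by
        push_cast
        field_simp
        ring
      refine (congrArg abs this).trans ?_
      rw [abs_of_nonneg (by positivity)]
      push_cast
      rfl
    rw [e] at h
    exact h
  have h2 : ∀ i, MemLp (gridIncrement B T N i) 2 P := fun i =>
    (hB.isGaussianProcess.hasGaussianLaw_eval _).memLp_two.sub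
      (hB.isGaussianProcess.hasGaussianLaw_eval _).memLp_two
  have h0 : ∀ i, ∫ ω, gridIncrement B T N i ω ∂P = 0 := fun i => by
    rw [(hlaw i).integral_eq, integral_id_gaussianReal]
  have hsq : ∀ i, ∫ ω, gridIncrement B T N i ω ^ 2 ∂P = T / N := fun i => by
    rw [← variance_of_integral_eq_zero (hzm i).aemeasurable (h0 i), (hlaw i).variance_eq,
      variance_id_gaussianReal]
    push_cast
    rfl
  refine ⟨(memLp_runMax h2 N).integrable_sq, (integral_sq_runMax_le hzm hind h2 h0 N).trans ?_⟩
  simp only [hsq, Finset.sum_const, Finset.card_range, nsmul_eq_mul]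
  refine le_of_eq ?_
  field_simp

/-- The mean of the maximum of `|B|` over `[0, T]` is bounded. The maximum is the limit of maxima
over finer and finer grids, which are controlled by Doob's inequality; Fatou's lemma passes to the
limit. A measurable majorant `G` is provided because the maximum itself need not be measurable. -/
theorem exists_brownian_bound [IsProbabilityMeasure P] {B : ℝ≥0 → Ω → ℝ}
    (hm : ∀ t, Measurable (B t)) (hB : IsBrownianReal B P) {T : ℝ≥0} (hT : 0 < T) :
    ∃ G : Ω → ℝ≥0∞, Measurable G ∧ ∫⁻ ω, G ω ∂P ≤ ENNReal.ofReal (8 * T + 2) ∧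
      ∀ᵐ ω ∂P, ∀ t ≤ T, ‖B t ω‖ₑ ≤ G ω := by
  have hm' : ∀ t, Measurable ((-B) t) := fun t => (hm t).neg
  have hB' := hB.neg
  set U : ℕ → Ω → ℝ := fun N ω => (runMax (fun i => gridIncrement B T (N + 1) i ω) (N + 1) ^ 2 + 1)
    + (runMax (fun i => gridIncrement (-B) T (N + 1) i ω) (N + 1) ^ 2 + 1) with hU
  have hUm : ∀ N, Measurable (U N) := fun N => by
    have h1 : Measurable fun ω => runMax (fun i => gridIncrement B T (N + 1) i ω) (N + 1) :=
      measurable_runMax fun i _ => (hm _).sub (hm _)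
    have h2 : Measurable fun ω => runMax (fun i => gridIncrement (-B) T (N + 1) i ω) (N + 1) :=
      measurable_runMax fun i _ => (hm' _).sub (hm' _)
    fun_prop
  have hUint : ∀ N, ∫⁻ ω, ENNReal.ofReal (U N ω) ∂P ≤ ENNReal.ofReal (8 * T + 2) := fun N => by
    obtain ⟨i1, b1⟩ := integral_sq_runMax_gridIncrement_le hm hB.toIsPreBrownianReal T N.succ_pos
    obtain ⟨i2, b2⟩ := integral_sq_runMax_gridIncrement_le hm' hB'.toIsPreBrownianReal T N.succ_pos
    have j1 := i1.add (integrable_const (1 : ℝ))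
    have j2 := i2.add (integrable_const (1 : ℝ))
    have hi : Integrable (U N) P := j1.add j2
    rw [← ofReal_integral_eq_lintegral_ofReal hi (ae_of_all _ fun ω => by
      simp only [hU, Pi.zero_apply]
      positivity)]
    refine ENNReal.ofReal_le_ofReal ?_
    have e : ∫ ω, U N ω ∂P = (∫ ω, runMax (fun i => gridIncrement B T (N + 1) i ω) (N + 1) ^ 2 ∂P
        + 1) + (∫ ω, runMax (fun i => gridIncrement (-B) T (N + 1) i ω) (N + 1) ^ 2 ∂P + 1) := by
      have e1 := integral_add i1 (integrable_const (1 : ℝ))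
      have e2 := integral_add i2 (integrable_const (1 : ℝ))
      refine (integral_add j1 j2).trans ?_
      refine (congrArg₂ (· + ·) e1 e2).trans ?_
      simp
    rw [e]
    linarith
  refine ⟨fun ω => liminf (fun N => ENNReal.ofReal (U N ω)) atTop,
    Measurable.liminf fun N => (hUm N).ennreal_ofReal, ?_, ?_⟩
  · refine (lintegral_liminf_le fun N => (hUm N).ennreal_ofReal).trans ?_
    refine (liminf_le_liminf (Eventually.of_forall hUint)).trans ?_
    simp
  · filter_upwards [hB.cont, hB.eval_zero_ae_eq_zero] with ω hcont h0 t ht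
    have ht' : (t : ℝ) / T ≤ 1 := div_le_one_of_le₀ (by exact_mod_cast ht) T.2
    -- The grid points `T * k N / (N + 1)` converge to `t`.
    set k : ℕ → ℕ := fun N => ⌊(t : ℝ) / T * ((N + 1 : ℕ) : ℝ)⌋₊ with hk
    have hkN : ∀ N, k N ≤ N + 1 := fun N => by
      refine Nat.floor_le_of_le ?_
      exact mul_le_of_le_one_left (Nat.cast_nonneg _) ht'
    have hlim : Tendsto (fun N => T * ((k N : ℝ≥0) / ((N + 1 : ℕ) : ℝ≥0))) atTop (𝓝 t) := by
      rw [← NNReal.tendsto_coe]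
      have h1 := (tendsto_nat_floor_mul_div_atTop (R := ℝ) (a := (t : ℝ) / T) (by positivity)).comp
        (tendsto_natCast_atTop_atTop.comp (tendsto_add_atTop_nat 1))
      have h2 := h1.const_mul (T : ℝ)
      have h3 : (T : ℝ) * (t / T) = t := mul_div_cancel₀ _ (by positivity)
      rw [h3] at h2
      refine h2.congr fun N => ?_
      simp [hk]
    have hbound : ∀ N, ‖B (T * ((k N : ℝ≥0) / ((N + 1 : ℕ) : ℝ≥0))) ω‖ₑ
        ≤ ENNReal.ofReal (U N ω) := fun N => by
      rw [← ofReal_norm, Real.norm_eq_abs]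
      refine ENNReal.ofReal_le_ofReal ?_
      have h1 := sum_le_runMax (fun i => gridIncrement B T (N + 1) i ω) (hkN N)
      have h2 := sum_le_runMax (fun i => gridIncrement (-B) T (N + 1) i ω) (hkN N)
      rw [sum_gridIncrement] at h1 h2
      simp only [Pi.neg_apply, h0, sub_zero, neg_zero] at h1 h2
      have h3 := le_sq_div_add one_pos (runMax (fun i => gridIncrement B T (N + 1) i ω) (N + 1))
      have h4 := le_sq_div_add one_pos
        (runMax (fun i => gridIncrement (-B) T (N + 1) i ω) (N + 1))
      have h5 := sq_nonneg (runMax (fun i => gridIncrement B T (N + 1) i ω) (N + 1))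
      have h6 := sq_nonneg (runMax (fun i => gridIncrement (-B) T (N + 1) i ω) (N + 1))
      rw [abs_le]
      simp only [hU]
      constructor <;> linarith
    have hconv := (continuous_enorm.tendsto _).comp ((hcont.tendsto t).comp hlim)
    rw [← hconv.liminf_eq]
    exact liminf_le_liminf (Eventually.of_forall hbound)

theorem enorm_le_sum_enorm_apply {d : ℕ} (v : EuclideanSpace ℝ (Fin d)) :
    ‖v‖ₑ ≤ ∑ i, ‖v i‖ₑ := by
  have h : v = ∑ i, v i • EuclideanSpace.single i (1 : ℝ) := by
    ext j
    simp [Finset.sum_apply, Pi.single_apply]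
  conv_lhs => rw [h]
  refine (enorm_sum_le _ _).trans (Finset.sum_le_sum fun i _ => ?_)
  have h1 : ‖EuclideanSpace.single i (1 : ℝ)‖ₑ = 1 := by
    rw [← ofReal_norm, PiLp.norm_single]
    simp
  rw [enorm_smul, h1, mul_one]

theorem IsBrownianVec.exists_bound [IsProbabilityMeasure P] {d : ℕ} {W : ℝ≥0 → Ω → State d}
    (hW : IsBrownianVec W P) {T : ℝ≥0} (hT : 0 < T) :
    ∃ G : Ω → ℝ≥0∞, Measurable G ∧ ∫⁻ ω, G ω ∂P ≤ ENNReal.ofReal (d * (8 * T + 2)) ∧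
      ∀ᵐ ω ∂P, ∀ t ≤ T, ‖W t ω‖ₑ ≤ G ω := by
  choose G hGm hGi hGb using fun i => exists_brownian_bound
    (fun t => by have := hW.measurable t; fun_prop) (hW.brownian i) hT
  refine ⟨fun ω => ∑ i, G i ω, by fun_prop, ?_, ?_⟩
  · rw [lintegral_finsetSum _ fun i _ => hGm i]
    refine (Finset.sum_le_sum fun i _ => hGi i).trans (le_of_eq ?_)
    rw [ENNReal.ofReal_mul (Nat.cast_nonneg _)]
    simp
  · filter_upwards [ae_all_iff.2 hGb] with ω hω t ht
    exact (enorm_le_sum_enorm_apply _).trans (Finset.sum_le_sum fun i _ => hω i t ht)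

end Brownian

/-! ### The closed loop and its limiting fluctuation -/

/-- The action of a matrix, `act`, as a continuous linear map. -/
noncomputable def actL {d : ℕ} (S : Matrix (Fin d) (Fin d) ℝ) : State d →L[ℝ] State d :=
  Matrix.toEuclideanCLM (n := Fin d) (𝕜 := ℝ) S

theorem act_eq {d : ℕ} (S : Matrix (Fin d) (Fin d) ℝ) (v : State d) : act S v = actL S v := rfl

theorem actL_sub {d : ℕ} (S S' : Matrix (Fin d) (Fin d) ℝ) : actL (S - S') = actL S - actL S' :=
  map_sub _ S S'

theorem actL_comm {d : ℕ} {S S' : Matrix (Fin d) (Fin d) ℝ} (h : Commute S S') (v : State d) :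
    actL S (actL S' v) = actL S' (actL S v) := by
  have := (h.map (Matrix.toEuclideanCLM (n := Fin d) (𝕜 := ℝ))).eq
  exact congrArg (fun L : State d →L[ℝ] State d => L v) this

section

variable {d m : ℕ} {A : Matrix (Fin d) (Fin d) ℝ} {B : Matrix (Fin d) (Fin m) ℝ}
  {K : Matrix (Fin m) (Fin d) ℝ}

/-- The profile of the limiting fluctuation. Since `BK` commutes with `A - BK`, resonance turns the
Duhamel integral into multiplication by `t`. -/
noncomputable def fluctuation (A : Matrix (Fin d) (Fin d) ℝ) (B : Matrix (Fin d) (Fin m) ℝ)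
    (K : Matrix (Fin m) (Fin d) ℝ) (M : ℝ) (x : ℝ → State d) (t : ℝ) : State d :=
  (M * t) • actL (B * K) (actL (A - B * K) (x t))

/-- The solution of the closed loop equation. -/
noncomputable def flow (A : Matrix (Fin d) (Fin d) ℝ) (B : Matrix (Fin d) (Fin m) ℝ)
    (K : Matrix (Fin m) (Fin d) ℝ) (x₀ : State d) (t : ℝ) : State d :=
  NormedSpace.exp (t • actL (A - B * K)) x₀

theorem flow_zero (x₀ : State d) : flow A B K x₀ 0 = x₀ := by
  have h : (0 : ℝ) • actL (A - B * K) = 0 :=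
    ContinuousLinearMap.ext fun v => zero_smul ℝ (actL (A - B * K) v)
  rw [flow, h, NormedSpace.exp_zero]
  rfl

theorem hasDerivAt_flow (x₀ : State d) (t : ℝ) :
    HasDerivAt (flow A B K x₀) (actL (A - B * K) (flow A B K x₀ t)) t := by
  have h := hasDerivAt_exp_smul_const' (𝕂 := ℝ) (actL (A - B * K)) t
  exact ((ContinuousLinearMap.apply ℝ (State d) x₀).hasFDerivAt.comp_hasDerivAt t h)

theorem continuous_flow (x₀ : State d) : Continuous (flow A B K x₀) :=
  continuous_iff_continuousAt.2 fun t => (hasDerivAt_flow x₀ t).continuousAt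

theorem integral_flow (x₀ : State d) (t : ℝ) :
    ∫ s in (0 : ℝ)..t, actL (A - B * K) (flow A B K x₀ s) = flow A B K x₀ t - x₀ := by
  rw [intervalIntegral.integral_eq_sub_of_hasDerivAt (fun s _ => hasDerivAt_flow x₀ s)
    (((actL (A - B * K)).continuous.comp (continuous_flow x₀)).intervalIntegrable _ _), flow_zero]

theorem IsClosedLoop.eqOn_flow {x₀ : State d} {x : ℝ → State d} (hx : IsClosedLoop A B K x₀ x) :
    Set.EqOn x (flow A B K x₀) (Set.Ici 0) := by
  refine eqOn_of_linear_integral_eq (F := actL (A - B * K)) (b := fun _ => x₀) hx.cont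
    (continuous_flow x₀).continuousOn (fun t ht => hx.eqn t ht) fun t _ => ?_
  rw [integral_flow]
  abel

theorem commute_sub (hcomm : Commute A (B * K)) (v : State d) :
    actL (B * K) (actL (A - B * K) v) = actL (A - B * K) (actL (B * K) v) :=
  actL_comm (hcomm.symm.sub_right (Commute.refl _)) v

theorem isLimitFluctuation_fluctuation (hcomm : Commute A (B * K)) (M σ : ℝ) {x₀ : State d}
    {x : ℝ → State d} (hx : IsClosedLoop A B K x₀ x) :
    IsLimitFluctuation A B K M σ x fun t => σ • fluctuation A B K M (flow A B K x₀) t := by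
  set F := actL (A - B * K) with hF
  set D := actL (B * K) with hD
  set y := flow A B K x₀ with hy
  have hyc : Continuous y := continuous_flow x₀
  have hQc : Continuous fun t => σ • fluctuation A B K M y t := by
    unfold fluctuation
    fun_prop
  have hd : ∀ t, HasDerivAt (fun t => σ • fluctuation A B K M y t)
      (F (σ • fluctuation A B K M y t) + σ • D (M • F (y t))) t := fun t => by
    have h1 : HasDerivAt (fun t => D (F (y t))) (D (F (F (y t)))) t :=
      (D.comp F).hasFDerivAt.comp_hasDerivAt t (hasDerivAt_flow x₀ t)
    have h2 := ((((hasDerivAt_id t).const_mul M).smul h1).const_smul σ)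
    convert! h2 using 1
    simp only [fluctuation, map_smul, ← hF, ← hD, id, mul_one, smul_add]
    rw [hF, hD, ← commute_sub hcomm (actL (A - B * K) (y t))]
  refine ⟨hQc.continuousOn, fun t ht => ?_⟩
  have hxy : ∫ s in (0 : ℝ)..t, act (A - B * K) (x s) = ∫ s in (0 : ℝ)..t, F (y s) := by
    refine intervalIntegral.integral_congr fun s hs => ?_
    rw [Set.uIcc_of_le ht] at hs
    simp only [hx.eqOn_flow hs.1, act_eq]
    rfl
  have hi1 : IntervalIntegrable (fun s => F (σ • fluctuation A B K M y s)) volume 0 t :=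
    (F.continuous.comp hQc).intervalIntegrable _ _
  have hi2 : IntervalIntegrable (fun s => F (y s)) volume 0 t :=
    (F.continuous.comp hyc).intervalIntegrable _ _
  have hi3 : IntervalIntegrable (fun s => σ • D (M • F (y s))) volume 0 t :=
    Continuous.intervalIntegrable (by fun_prop) _ _
  have hint := intervalIntegral.integral_eq_sub_of_hasDerivAt (a := 0) (b := t)
    (fun s _ => hd s) (hi1.add hi3)
  have h0 : σ • fluctuation A B K M y 0 = 0 := by simp [fluctuation]
  have h3 : ∫ s in (0 : ℝ)..t, σ • D (M • F (y s)) = σ • D (M • ∫ s in (0 : ℝ)..t, F (y s)) := by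
    simp only [map_smul, intervalIntegral.integral_smul]
    rw [D.intervalIntegral_comp_comm hi2]
  rw [hxy, act_eq, ← hD, ← h3]
  simp only [act_eq, ← hF]
  rw [← intervalIntegral.integral_add hi1 hi3, hint, h0, sub_zero]

theorem IsLimitFluctuation.eqOn {M σ : ℝ} {x Q Q' : ℝ → State d}
    (hQ : IsLimitFluctuation A B K M σ x Q) (hQ' : IsLimitFluctuation A B K M σ x Q') :
    Set.EqOn Q' Q (Set.Ici 0) :=
  eqOn_of_linear_integral_eq (F := actL (A - B * K)) hQ'.cont hQ.cont
    (b := fun t => σ • act (B * K) (M • ∫ s in (0 : ℝ)..t, act (A - B * K) (x s)))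
    (fun t ht => (hQ'.eqn t ht).trans (add_comm _ _))
    fun t ht => (hQ.eqn t ht).trans (add_comm _ _)

theorem exists_norm_fluctuation_le (A : Matrix (Fin d) (Fin d) ℝ) (B : Matrix (Fin d) (Fin m) ℝ)
    (K : Matrix (Fin m) (Fin d) ℝ) (M R T : ℝ) :
    ∃ C, 0 ≤ C ∧ ∀ x₀ : State d, ‖x₀‖ ≤ R → ∀ t ∈ Set.Icc 0 T,
      ‖fluctuation A B K M (flow A B K x₀) t‖ ≤ C := by
  set F := actL (A - B * K) with hF
  set D := actL (B * K) with hD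
  refine ⟨|M| * |T| * (‖D‖ * (‖F‖ * (2 * Real.exp ((2 * ‖F‖ + 1) * T) * |R|))), by positivity,
    fun x₀ hx₀ t ht => ?_⟩
  have h1 := norm_le_of_linear_ode (T := T) (hasDerivAt_flow (A := A) (B := B) (K := K) x₀) t ht
  rw [flow_zero] at h1
  have h2 : ‖x₀‖ ≤ |R| := hx₀.trans (le_abs_self R)
  have h3 : |t| ≤ |T| := abs_le_abs_of_nonneg ht.1 ht.2
  rw [fluctuation, norm_smul, Real.norm_eq_abs, abs_mul]
  gcongr
  refine (D.le_opNorm _).trans ?_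
  gcongr
  refine (F.le_opNorm _).trans ?_
  gcongr
  refine h1.trans ?_
  rw [← hF]
  gcongr

/-! ### The approximation in mean -/

theorem IsRandomInput.isWaitingTimes {d : ℕ} {Ω : Type u} [MeasurableSpace Ω] {ν : Measure ℝ}
    {ξ : ℕ → Ω → ℝ} {W : ℝ≥0 → Ω → State d} {P : Measure Ω} (h : IsRandomInput ν ξ W P) :
    IsWaitingTimes ν ξ P :=
  ⟨h.measurable, h.law, h.iindep⟩

/-- The state is approximated in mean, uniformly on `[0, T]` and up to `ε + n ^ (-3 / 2)`, by its
first order expansion with the fluctuation of sign `+1`. -/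
theorem exists_lintegral_iSup_le (hcomm : Commute A (B * K)) {ν : Measure ℝ}
    [IsProbabilityMeasure ν] (hpos : ∀ᵐ y ∂ν, 0 < y)
    (hmgf : ∃ r : ℝ, 0 < r ∧ Integrable (fun y => Real.exp (r * y)) ν) (R : ℝ) {T : ℝ}
    (hT : 0 < T) :
    ∃ C, 0 < C ∧ ∀ x₀ : State d, ‖x₀‖ ≤ R →
      ∀ (Ω : Type u) [MeasurableSpace Ω] (P : Measure Ω) [IsProbabilityMeasure P]
        (ξ : ℕ → Ω → ℝ) (W : ℝ≥0 → Ω → State d) (X : ℝ → Ω → State d) (ε : ℝ) (n : ℕ),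
        IsRandomInput ν ξ W P → 0 < ε → 0 < n → IsSampledSolution A B K x₀ ξ W P ε n X →
        ∫⁻ ω, (⨆ t ∈ Set.Icc (0 : ℝ) T, ‖X t ω - flow A B K x₀ t
          - (1 / (n : ℝ)) • fluctuation A B K (meanAge ν) (flow A B K x₀) t‖ₑ) ∂P
          ≤ ENNReal.ofReal (C * (ε + √n / n ^ 2)) := by
  obtain ⟨C₁, hC₁, hdet⟩ := exists_norm_sub_approx_le (A := actL A) (D := actL (B * K))
    (F := actL (A - B * K)) (actL_sub _ _) (commute_sub hcomm) hT.le (meanAge ν)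
  obtain ⟨C₂, hC₂, hage⟩ := exists_age_error.{u} hpos hmgf hT
  set C₃ : ℝ := d * (8 * T + 2) with hC₃
  refine ⟨C₁ * (C₃ + |R| * C₂ + 1), by positivity, ?_⟩
  intro x₀ hx₀ Ω _ P _ ξ W X ε n hin hε hn hX
  obtain ⟨Y, hYm, hYi, hY⟩ := hage Ω P ξ hin.isWaitingTimes n hn
  obtain ⟨G, hGm, hGi, hG⟩ := hin.brownian.exists_bound (Real.toNNReal_pos.2 hT)
  rw [Real.coe_toNNReal T hT.le, ← hC₃] at hGi
  have hpath : ∀ᵐ ω ∂P, (⨆ t ∈ Set.Icc (0 : ℝ) T, ‖X t ω - flow A B K x₀ t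
      - (1 / (n : ℝ)) • fluctuation A B K (meanAge ν) (flow A B K x₀) t‖ₑ)
      ≤ ENNReal.ofReal C₁ * (ENNReal.ofReal ε * G ω
        + ENNReal.ofReal |R| * ENNReal.ofReal (Y ω)) := by
    filter_upwards [hY, hG, hX.cont, hX.eqn] with ω hYω hGω hXc hXe
    obtain ⟨hlp, I, J, g, hI, hJ, hg, hsum⟩ := hYω
    refine iSup₂_le fun t ht => ?_
    -- The bound is trivial on the null set where the majorant of the Brownian path is infinite.
    rcases eq_or_ne (G ω) ⊤ with hGtop | hGtop
    · rw [hGtop, ENNReal.mul_top (by simpa using hε), top_add,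
        ENNReal.mul_top (by simpa using hC₁)]
      exact le_top
    have hbound := hdet (flow A B K x₀) (fun t => X t ω) (fun t => ε • W t.toNNReal ω)
      (fun t => lastSample ξ n t ω) (1 / n) (ε * (G ω).toReal) I J g (hasDerivAt_flow x₀)
      (by positivity) (hXc.mono Set.Icc_subset_Ici_self)
      (hlp.monotoneOn.mono Set.Icc_subset_Ici_self) (fun s hs => hlp.mem_Icc hs.1)
      (fun s hs => hlp.continuousWithinAt hs.1)
      (fun t ht => by
        have h := hXe t.toNNReal
        rw [Real.coe_toNNReal t ht.1] at h
        rw [flow_zero]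
        exact h)
      (fun t ht => by
        rw [norm_smul, Real.norm_eq_abs, abs_of_pos hε]
        gcongr
        have h := hGω t.toNNReal (Real.toNNReal_le_toNNReal ht.2)
        rw [← toReal_enorm]
        exact ENNReal.toReal_mono hGtop h)
      hI hJ hg t ht
    rw [flow_zero] at hbound
    have h1 : ‖x₀‖ * (J + 1 / n * I + g) ≤ |R| * (Y ω).toNNReal := by
      calc ‖x₀‖ * (J + 1 / n * I + g) ≤ ‖x₀‖ * (Y ω).toNNReal := by
            gcongr
            exact hsum.trans (Real.le_coe_toNNReal _)
        _ ≤ |R| * (Y ω).toNNReal := by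
            gcongr
            exact hx₀.trans (le_abs_self R)
    have h2 : ‖X t ω - flow A B K x₀ t
        - (1 / (n : ℝ)) • fluctuation A B K (meanAge ν) (flow A B K x₀) t‖
        ≤ C₁ * (ε * (G ω).toReal + |R| * (Y ω).toNNReal) := by
      refine hbound.trans ?_
      gcongr
    rw [← ofReal_norm]
    refine (ENNReal.ofReal_le_ofReal h2).trans (le_of_eq ?_)
    rw [ENNReal.ofReal_mul hC₁.le, ENNReal.ofReal_add (by positivity) (by positivity),
      ENNReal.ofReal_mul hε.le, ENNReal.ofReal_mul (abs_nonneg R), ENNReal.ofReal_toReal hGtop,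
      ENNReal.ofReal_coe_nnreal]
    rfl
  refine (lintegral_mono_ae hpath).trans ?_
  rw [lintegral_const_mul _ (by fun_prop), lintegral_add_left (by fun_prop),
    lintegral_const_mul _ hGm, lintegral_const_mul _ (by fun_prop)]
  have hx0 : 0 ≤ √(n : ℝ) / n ^ 2 := by positivity
  calc ENNReal.ofReal C₁ * (ENNReal.ofReal ε * ∫⁻ ω, G ω ∂P
        + ENNReal.ofReal |R| * ∫⁻ ω, ENNReal.ofReal (Y ω) ∂P)
      ≤ ENNReal.ofReal C₁ * (ENNReal.ofReal ε * ENNReal.ofReal C₃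
        + ENNReal.ofReal |R| * ENNReal.ofReal (C₂ * (√n / n ^ 2))) := by
        gcongr
    _ = ENNReal.ofReal (C₁ * (ε * C₃ + |R| * (C₂ * (√n / n ^ 2)))) := by
        rw [ENNReal.ofReal_mul hC₁.le, ENNReal.ofReal_add (by positivity) (by positivity),
          ENNReal.ofReal_mul hε.le, ENNReal.ofReal_mul (abs_nonneg R)]
    _ ≤ ENNReal.ofReal (C₁ * (C₃ + |R| * C₂ + 1) * (ε + √n / n ^ 2)) := by
        refine ENNReal.ofReal_le_ofReal ?_
        have hC₃0 : 0 ≤ C₃ := by positivity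
        have h1 : 0 ≤ C₃ * (√n / n ^ 2) := mul_nonneg hC₃0 hx0
        have h2 : 0 ≤ |R| * C₂ * ε := by positivity
        rw [mul_assoc]
        gcongr
        linarith

end

/-! ### Rates -/

theorem IsRegimeThree.tendsto_mul_zero {ε : ℕ → ℝ} (h : IsRegimeThree ε) :
    Tendsto (fun n : ℕ => (n : ℝ) * ε n) atTop (𝓝 0) := by
  refine h.tendsto_top.inv_tendsto_atTop.congr fun n => ?_
  simp only [Pi.inv_apply, one_div, inv_inv]

/-- The comparison of rates `ε + n ^ (-3 / 2) + 1 / n ≲ n ^ (-1 / 4) + ε √n`. -/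
theorem rate_le {C C' ε : ℝ} (hC : 0 ≤ C) (hC' : 0 ≤ C') (hε : 0 ≤ ε) {n : ℕ} (hn : 0 < n) :
    C * (ε + √n / n ^ 2) + C' * (1 / n)
      ≤ (1 / (n : ℝ) ^ (1 / 4 : ℝ) + ε * √n) * (C + C') := by
  have hn0 : (0 : ℝ) < n := by exact_mod_cast hn
  have hn1 : (1 : ℝ) ≤ n := by exact_mod_cast hn
  have hs1 : 1 ≤ √(n : ℝ) := Real.one_le_sqrt.2 hn1
  have hs2 : √(n : ℝ) ≤ n := Real.sqrt_le_iff.2 ⟨hn0.le, by nlinarith⟩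
  have h1 : ε ≤ ε * √n := le_mul_of_one_le_right hε hs1
  have h2 : √(n : ℝ) / n ^ 2 ≤ 1 / n := by
    rw [div_le_div_iff₀ (by positivity) hn0]
    nlinarith
  have h3 : 1 / (n : ℝ) ≤ 1 / (n : ℝ) ^ (1 / 4 : ℝ) := by
    have : (n : ℝ) ^ (1 / 4 : ℝ) ≤ (n : ℝ) ^ (1 : ℝ) :=
      Real.rpow_le_rpow_of_exponent_le hn1 (by norm_num)
    rw [Real.rpow_one] at this
    gcongr
  have h4 : 0 ≤ ε * √n := by positivity
  calc C * (ε + √n / n ^ 2) + C' * (1 / n)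
      ≤ C * (ε * √n + 1 / (n : ℝ) ^ (1 / 4 : ℝ)) + C' * (1 / (n : ℝ) ^ (1 / 4 : ℝ) + ε * √n) := by
        refine add_le_add (mul_le_mul_of_nonneg_left ?_ hC) (mul_le_mul_of_nonneg_left ?_ hC')
        · exact add_le_add h1 (h2.trans h3)
        · linarith
    _ = _ := by ring

end SampledControl

theorem theorem2p3 {d m : ℕ} (A : Matrix (Fin d) (Fin d) ℝ) (B : Matrix (Fin d) (Fin m) ℝ)
    (K : Matrix (Fin m) (Fin d) ℝ) (hA : IsUnit A) (hcomm : Commute A (B * K))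
    (ν : Measure ℝ) [IsProbabilityMeasure ν] (hpos : ∀ᵐ y ∂ν, 0 < y)
    (hmgf : ∃ r : ℝ, 0 < r ∧ Integrable (fun y => Real.exp (r * y)) ν) (R : ℝ) :
    ∃ C : ℝ → ℝ, (∀ T, 0 < T → 0 < C T) ∧
      ∀ ε : ℕ → ℝ, SampledControl.IsRegimeThree ε →
      ∃ n₀ : ℕ, 0 < n₀ ∧
      ∀ x₀ : SampledControl.State d, ‖x₀‖ ≤ R →
      ∀ x : ℝ → SampledControl.State d, SampledControl.IsClosedLoop A B K x₀ x →
      ∀ σ : ℝ, σ = -1 ∨ σ = 1 →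
      ∃ Q : ℝ → SampledControl.State d,
        SampledControl.IsLimitFluctuation A B K (SampledControl.meanAge ν) σ x Q ∧
        (∀ Q' : ℝ → SampledControl.State d,
          SampledControl.IsLimitFluctuation A B K (SampledControl.meanAge ν) σ x Q' →
          Set.EqOn Q' Q (Set.Ici 0)) ∧
        ∀ (Ω : Type u) [MeasurableSpace Ω] (P : Measure Ω) [IsProbabilityMeasure P]
          (ξ : ℕ → Ω → ℝ) (W : ℝ≥0 → Ω → SampledControl.State d)
          (X : ℕ → ℝ → Ω → SampledControl.State d),
          SampledControl.IsRandomInput ν ξ W P →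
          (∀ n : ℕ, 0 < n → SampledControl.IsSampledSolution A B K x₀ ξ W P (ε n) n (X n)) →
          (∀ T : ℝ, 0 < T → ∀ n : ℕ, n₀ < n →
            ∫⁻ ω, (⨆ t ∈ Set.Icc (0 : ℝ) T, ‖X n t ω - x t - (1 / (n : ℝ)) • Q t‖ₑ) ∂P ≤
              ENNReal.ofReal ((1 / (n : ℝ) ^ (1 / 4 : ℝ) + ε n * Real.sqrt n) * C T)) ∧
          (σ = 1 → ∀ T : ℝ, 0 < T →
            Tendsto (fun n : ℕ => ∫⁻ ω, (⨆ t ∈ Set.Icc (0 : ℝ) T,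
              ‖(1 / (n : ℝ))⁻¹ • (X n t ω - x t) - Q t‖ₑ) ∂P) atTop (𝓝 0)) := by
  choose! C₁ hC₁ hmain using fun T (hT : 0 < T) =>
    SampledControl.exists_lintegral_iSup_le.{u} (A := A) (B := B) (K := K) hcomm hpos hmgf R hT
  choose C₂ hC₂ hQbound using fun T =>
    SampledControl.exists_norm_fluctuation_le A B K (SampledControl.meanAge ν) R T
  -- The estimate holds for every `n > 0`, so the choice of `n₀` is immaterial.
  refine ⟨fun T => C₁ T + 2 * C₂ T, fun T hT => by
    have := hC₁ T hT
    have := hC₂ T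
    positivity, fun ε hε => ⟨1, one_pos, fun x₀ hx₀ x hx σ hσ => ?_⟩⟩
  set q := SampledControl.fluctuation A B K (SampledControl.meanAge ν)
    (SampledControl.flow A B K x₀) with hq
  have hQ := SampledControl.isLimitFluctuation_fluctuation hcomm (SampledControl.meanAge ν) σ hx
  refine ⟨fun t => σ • q t, hQ, fun Q' hQ' => hQ.eqOn hQ', ?_⟩
  intro Ω _ P _ ξ W X hin hX
  refine ⟨fun T hT n hn => ?_, fun hσ1 T hT => ?_⟩
  · have hn0 : 0 < n := by omega
    have h1 := hmain T hT x₀ hx₀ Ω P ξ W (X n) (ε n) n hin (hε.pos n) hn0 (hX n hn0)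
    have hpt : ∀ ω, (⨆ t ∈ Set.Icc (0 : ℝ) T, ‖X n t ω - x t - (1 / (n : ℝ)) • σ • q t‖ₑ)
        ≤ (⨆ t ∈ Set.Icc (0 : ℝ) T, ‖X n t ω - SampledControl.flow A B K x₀ t
          - (1 / (n : ℝ)) • q t‖ₑ) + ENNReal.ofReal (2 * C₂ T * (1 / n)) := by
      -- For `σ = -1` the wrong sign costs `2 * q / n`, which the rate `n ^ (-1 / 4)` absorbs.
      refine fun ω => iSup₂_le fun t ht => ?_
      have e : X n t ω - x t - (1 / (n : ℝ)) • σ • q t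
          = (X n t ω - SampledControl.flow A B K x₀ t - (1 / (n : ℝ)) • q t)
            + ((1 - σ) * (1 / (n : ℝ))) • q t := by
        rw [hx.eqOn_flow ht.1]
        module
      rw [e]
      refine (enorm_add_le _ _).trans (add_le_add (le_iSup₂_of_le t ht le_rfl) ?_)
      rw [← ofReal_norm, norm_smul, norm_mul, Real.norm_eq_abs, Real.norm_eq_abs,
        abs_of_nonneg (by positivity : (0 : ℝ) ≤ 1 / n)]
      refine ENNReal.ofReal_le_ofReal ?_
      have h2 : |1 - σ| ≤ 2 := by rcases hσ with rfl | rfl <;> norm_num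
      have h3 := hQbound T x₀ hx₀ t ht
      calc |1 - σ| * (1 / n) * ‖q t‖ ≤ 2 * (1 / n) * C₂ T := by gcongr
        _ = 2 * C₂ T * (1 / n) := by ring
    refine (lintegral_mono hpt).trans ?_
    rw [lintegral_add_right _ measurable_const, lintegral_const, measure_univ, mul_one]
    have hnn : 0 ≤ C₁ T * (ε n + √n / n ^ 2) := by
      have := hC₁ T hT
      have := (hε.pos n).le
      positivity
    refine (add_le_add_left h1 _).trans ?_
    rw [← ENNReal.ofReal_add hnn (by have := hC₂ T; positivity)]
    exact ENNReal.ofReal_le_ofReal (SampledControl.rate_le (hC₁ T hT).le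
      (by have := hC₂ T; positivity) (hε.pos n).le hn0)
  -- At scale `1 / n` the error `ε + n ^ (-3 / 2)` becomes `n * ε + n ^ (-1 / 2)`.
  · have hlim : Tendsto (fun n : ℕ => ENNReal.ofReal (C₁ T * (n * ε n + (√n)⁻¹))) atTop (𝓝 0) := by
      have h1 : Tendsto (fun n : ℕ => (√(n : ℝ))⁻¹) atTop (𝓝 0) :=
        (Real.tendsto_sqrt_atTop.comp tendsto_natCast_atTop_atTop).inv_tendsto_atTop
      have h2 := (hε.tendsto_mul_zero.add h1).const_mul (C₁ T)
      simpa using ENNReal.tendsto_ofReal h2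
    refine tendsto_of_tendsto_of_tendsto_of_le_of_le' tendsto_const_nhds hlim
      (Eventually.of_forall fun _ => zero_le) ?_
    filter_upwards [eventually_gt_atTop 0] with n hn
    have hn0 : (0 : ℝ) < n := by exact_mod_cast hn
    have h1 := hmain T hT x₀ hx₀ Ω P ξ W (X n) (ε n) n hin (hε.pos n) hn (hX n hn)
    have hpt : ∀ ω, (⨆ t ∈ Set.Icc (0 : ℝ) T, ‖(1 / (n : ℝ))⁻¹ • (X n t ω - x t) - σ • q t‖ₑ)
        ≤ ENNReal.ofReal n * ⨆ t ∈ Set.Icc (0 : ℝ) T,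
          ‖X n t ω - SampledControl.flow A B K x₀ t - (1 / (n : ℝ)) • q t‖ₑ := by
      refine fun ω => iSup₂_le fun t ht => ?_
      have e : (1 / (n : ℝ))⁻¹ • (X n t ω - x t) - σ • q t
          = (n : ℝ) • (X n t ω - SampledControl.flow A B K x₀ t - (1 / (n : ℝ)) • q t) := by
        rw [hx.eqOn_flow ht.1, hσ1, smul_sub (n : ℝ) _ ((1 / (n : ℝ)) • q t), smul_smul,
          mul_one_div_cancel hn0.ne', one_div, inv_inv]
      rw [e, enorm_smul, Real.enorm_of_nonneg hn0.le]
      gcongr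
      exact le_iSup₂_of_le t ht le_rfl
    refine (lintegral_mono hpt).trans ?_
    rw [lintegral_const_mul' _ _ ENNReal.ofReal_ne_top]
    refine (mul_le_mul_right h1 _).trans ?_
    rw [← ENNReal.ofReal_mul hn0.le]
    refine ENNReal.ofReal_le_ofReal (le_of_eq ?_)
    have hs : √(n : ℝ) ^ 2 = n := Real.sq_sqrt hn0.le
    have hs0 : √(n : ℝ) ≠ 0 := (Real.sqrt_pos.2 hn0).ne'
    have e2 : (n : ℝ) * (√n / n ^ 2) = (√n)⁻¹ := by
      field_simp
      exact hs
    linear_combination C₁ T * e2
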